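/- Let $\varepsilon>0$, let $\mathfrak H=L^2(\mathbb R^3,\mathbb C^4)$, and let $\beta=\begin{pmatrix} I_2&0\\0&-I_2\end{pmatrix}$ and $\alpha_k=\begin{pmatrix}0&\sigma_k\\ \sigma_k&0\end{pmatrix}$, $k=1,2,3$, be the Dirac matrices, where $\sigma_1,\sigma_2,\sigma_3$ are the Pauli matrices. Let $3<r\le\infty$ and, for $\mu=0,1,2,3$, let $A_\mu=B_\mu+\tilde B_\mu$ with $B_\mu\in C^1(\mathbb R,L^r(\mathbb R^3,\mathbb R))$ and $\tilde B_\mu\in C^1(\mathbb R,L^\infty(\mathbb R^3,\mathbb R))$. For $t\in\mathbb R$ consider in $\mathfrak H$ the Dirac Hamilton operator $$H(t)=\sum_{k=1}^3\alpha_k\bigl(-i\varepsilon\partial_{x_k}-A_k(t,\cdot)\bigr)+\beta-A_0(t,\cdot)I_4 .$$ Then for every $t\in\mathbb R$ the operator $H(t)$ is well defined on the domain $\mathcal D(H(t))=H^1(\mathbb R^3,\mathbb C^4)$ (that is, the potential terms map $H^1(\mathbb R^3,\mathbb C^4)$ into $\mathfrak H$), and it is self-adjoint on this domain. Moreover, there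 exists a unitary propagator $(U_H(t;s))_{t,s\in\mathbb R}$ on $\mathfrak H$, that is, a family of unitary operators with $U_H(s;s)=1$ and $U_H(t;s)U_H(s;u)=U_H(t;u)$ for all $t,s,u\in\mathbb R$ such that $(t,s)\mapsto U_H(t;s)\psi$ is continuous from $\mathbb R^2$ to $\mathfrak H$ for every $\psi\in\mathfrak H$, with the following property: for all $\psi\in H^1(\mathbb R^3,\mathbb C^4)$ and all $s,t\in\mathbb R$ one has $U_H(t;s)\psi\in H^1(\mathbb R^3,\mathbb C^4)$, the map $t\mapsto U_H(t;s)\psi$ is differentiable in $\mathfrak H$, and $$i\,\partial_tU_H(t;s)\psi=H(t)U_H(t;s)\psi .$$ -/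

import Mathlib

open MeasureTheory LineDeriv
open scoped ENNReal SchwartzMap

noncomputable section

namespace DiracEvolution

/-- The position space `ℝ³`, with the Euclidean norm and Lebesgue measure. -/
abbrev Space : Type := EuclideanSpace ℝ (Fin 3)

/-- The spinor space `ℂ⁴`, with the standard Hermitian inner product. -/
abbrev Spinor : Type := EuclideanSpace ℂ (Fin 4)

/-- The Hilbert space `L²(ℝ³, ℂ⁴)`. -/
abbrev SpinorL2 : Type := Lp Spinor 2 (volume : Measure Space)

/-- The Pauli matrices `σ₁, σ₂, σ₃`, indexed by `0, 1, 2`. -/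
def pauli : Fin 3 → Matrix (Fin 2) (Fin 2) ℂ :=
  ![!![0, 1; 1, 0], !![0, -Complex.I; Complex.I, 0], !![1, 0; 0, -1]]

/-- A `4 × 4` matrix written in four `2 × 2` blocks. -/
def ofBlocks (a b c d : Matrix (Fin 2) (Fin 2) ℂ) : Matrix (Fin 4) (Fin 4) ℂ :=
  Matrix.reindex (finSumFinEquiv : Fin 2 ⊕ Fin 2 ≃ Fin 4) (finSumFinEquiv : Fin 2 ⊕ Fin 2 ≃ Fin 4)
    (Matrix.fromBlocks a b c d)

/-- The Dirac matrices `α₁, α₂, α₃`, indexed by `0, 1, 2`. -/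
def diracAlpha (k : Fin 3) : Matrix (Fin 4) (Fin 4) ℂ := ofBlocks 0 (pauli k) (pauli k) 0

/-- The Dirac matrix `β`. -/
def diracBeta : Matrix (Fin 4) (Fin 4) ℂ := ofBlocks 1 0 0 (-1)

/-- A constant `4 × 4` matrix acting pointwise on `L²(ℝ³, ℂ⁴)`. -/
def matrixAct (M : Matrix (Fin 4) (Fin 4) ℂ) : SpinorL2 →L[ℂ] SpinorL2 :=
  ContinuousLinearMap.compLpL 2 volume (Matrix.toEuclideanCLM (n := Fin 4) (𝕜 := ℂ) M)

/-- The Sobolev space `H¹(ℝ³, ℂ⁴)`, as a subspace of `L²(ℝ³, ℂ⁴)`. -/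
def sobolevH1 : Submodule ℂ SpinorL2 where
  carrier := {ψ | TemperedDistribution.MemSobolev 1 2 (ψ : 𝓢'(Space, Spinor))}
  zero_mem' := by
    have h : ((0 : SpinorL2) : 𝓢'(Space, Spinor)) = 0 :=
      map_zero (Lp.toTemperedDistributionCLM Spinor (volume : Measure Space) 2)
    change TemperedDistribution.MemSobolev 1 2 ((0 : SpinorL2) : 𝓢'(Space, Spinor))
    rw [h]
    exact TemperedDistribution.memSobolev_fun_zero Space Spinor 1 2
  add_mem' := by
    intro f g hf hg
    have h : ((f + g : SpinorL2) : 𝓢'(Space, Spinor)) = (f : 𝓢'(Space, Spinor)) + g :=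
      map_add (Lp.toTemperedDistributionCLM Spinor (volume : Measure Space) 2) f g
    change TemperedDistribution.MemSobolev 1 2 ((f + g : SpinorL2) : 𝓢'(Space, Spinor))
    rw [h]
    exact TemperedDistribution.MemSobolev.add hf hg
  smul_mem' := by
    intro c f hf
    have h : ((c • f : SpinorL2) : 𝓢'(Space, Spinor)) = c • (f : 𝓢'(Space, Spinor)) :=
      map_smul (Lp.toTemperedDistributionCLM Spinor (volume : Measure Space) 2) c f
    change TemperedDistribution.MemSobolev 1 2 ((c • f : SpinorL2) : 𝓢'(Space, Spinor))
    rw [h]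
    exact TemperedDistribution.MemSobolev.smul c hf

theorem toTemperedDistribution_injective {f g : SpinorL2}
    (h : (f : 𝓢'(Space, Spinor)) = g) : f = g :=
  LinearMap.ker_eq_bot.mp
    (Lp.ker_toTemperedDistributionCLM_eq_bot (F := Spinor) (μ := (volume : Measure Space)) (p := 2)) h

theorem exists_partial (k : Fin 3) (ψ : sobolevH1) :
    ∃ g : SpinorL2, (g : 𝓢'(Space, Spinor)) =
      ∂_{(EuclideanSpace.single k (1 : ℝ) : Space)} ((ψ : SpinorL2) : 𝓢'(Space, Spinor)) := by
  have h := TemperedDistribution.MemSobolev.lineDerivOp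
    (show TemperedDistribution.MemSobolev 1 2 ((ψ : SpinorL2) : 𝓢'(Space, Spinor)) from ψ.2)
    (m := (EuclideanSpace.single k (1 : ℝ) : Space))
  rw [sub_self, TemperedDistribution.memSobolev_zero_iff] at h
  obtain ⟨g, hg⟩ := h
  exact ⟨g, hg.symm⟩

/-- The distributional derivative `∂ₖψ ∈ L²(ℝ³, ℂ⁴)` of `ψ ∈ H¹(ℝ³, ℂ⁴)`. -/
def partialDeriv (k : Fin 3) : sobolevH1 →ₗ[ℂ] SpinorL2 where
  toFun ψ := (exists_partial k ψ).choose
  map_add' ψ φ := by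
    apply toTemperedDistribution_injective
    have h : ∀ f g : SpinorL2, ((f + g : SpinorL2) : 𝓢'(Space, Spinor)) = (f : 𝓢'(Space, Spinor)) + g :=
      map_add (Lp.toTemperedDistributionCLM Spinor (volume : Measure Space) 2)
    rw [h, (exists_partial k _).choose_spec, (exists_partial k _).choose_spec,
      (exists_partial k _).choose_spec, Submodule.coe_add, h, lineDerivOp_add]
  map_smul' c ψ := by
    apply toTemperedDistribution_injective
    have h : ∀ (c : ℂ) (f : SpinorL2),
        ((c • f : SpinorL2) : 𝓢'(Space, Spinor)) = c • (f : 𝓢'(Space, Spinor)) :=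
      map_smul (Lp.toTemperedDistributionCLM Spinor (volume : Measure Space) 2)
    rw [RingHom.id_apply, h, (exists_partial k _).choose_spec, (exists_partial k _).choose_spec,
      Submodule.coe_smul, h, lineDerivOp_smul]

theorem partialDeriv_spec (k : Fin 3) (ψ : sobolevH1) :
    ((partialDeriv k ψ : SpinorL2) : 𝓢'(Space, Spinor)) =
      ∂_{(EuclideanSpace.single k (1 : ℝ) : Space)} ((ψ : SpinorL2) : 𝓢'(Space, Spinor)) :=
  (exists_partial k ψ).choose_spec

/-- The free Dirac operator `-iε α·∇ + β` on `H¹(ℝ³, ℂ⁴)`. -/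
def freeDirac (ε : ℝ) : sobolevH1 →ₗ[ℂ] SpinorL2 :=
  (-Complex.I * (ε : ℂ)) • (∑ k, (matrixAct (diracAlpha k)).toLinearMap ∘ₗ partialDeriv k) +
    (matrixAct diracBeta).toLinearMap ∘ₗ sobolevH1.subtype

/-- The matrix `α·a + a₀ I₄` for `a = (a₀, a₁, a₂, a₃) ∈ ℝ⁴`. -/
def potentialMatrix (a : Fin 4 → ℝ) : Matrix (Fin 4) (Fin 4) ℂ :=
  (∑ k : Fin 3, (a k.succ : ℂ) • diracAlpha k) + (a 0 : ℂ) • 1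

/-- The function `x ↦ (α·A(x) + A₀(x) I₄) ψ(x)`. -/
def potentialMul (A : Fin 4 → Space → ℝ) (ψ : SpinorL2) : Space → Spinor :=
  fun x => Matrix.toEuclideanCLM (n := Fin 4) (𝕜 := ℂ) (potentialMatrix fun μ => A μ x) (ψ x)

theorem potentialMul_add (A : Fin 4 → Space → ℝ) (ψ φ : SpinorL2) :
    potentialMul A (ψ + φ) =ᵐ[volume] potentialMul A ψ + potentialMul A φ := by
  filter_upwards [Lp.coeFn_add ψ φ] with x hx
  simp only [potentialMul, hx, Pi.add_apply, map_add]

theorem potentialMul_smul (A : Fin 4 → Space → ℝ) (c : ℂ) (ψ : SpinorL2) :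
    potentialMul A (c • ψ) =ᵐ[volume] c • potentialMul A ψ := by
  filter_upwards [Lp.coeFn_smul c ψ] with x hx
  simp only [potentialMul, hx, Pi.smul_apply, map_smul]

/-- The `ψ ∈ H¹(ℝ³, ℂ⁴)` for which `(α·A + A₀ I₄) ψ` is square integrable. -/
def diracDomain (A : Fin 4 → Space → ℝ) : Submodule ℂ SpinorL2 where
  carrier := {ψ | ψ ∈ sobolevH1 ∧ MemLp (potentialMul A ψ) 2 volume}
  zero_mem' := by
    refine ⟨zero_mem _, ?_⟩
    have h := potentialMul_smul A 0 0
    rw [zero_smul, zero_smul] at h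
    exact (memLp_congr_ae h).mpr MemLp.zero
  add_mem' := by
    intro ψ φ hψ hφ
    exact ⟨add_mem hψ.1 hφ.1, (memLp_congr_ae (potentialMul_add A ψ φ)).mpr (hψ.2.add hφ.2)⟩
  smul_mem' := by
    intro c ψ hψ
    exact ⟨Submodule.smul_mem _ c hψ.1,
      (memLp_congr_ae (potentialMul_smul A c ψ)).mpr (hψ.2.const_smul c)⟩

theorem diracDomain_le (A : Fin 4 → Space → ℝ) : diracDomain A ≤ sobolevH1 := fun _ h => h.1

/-- Multiplication by `α·A + A₀ I₄`, as an operator into `L²(ℝ³, ℂ⁴)`. -/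
def potentialOp (A : Fin 4 → Space → ℝ) : diracDomain A →ₗ[ℂ] SpinorL2 where
  toFun ψ := ψ.2.2.toLp (potentialMul A ψ)
  map_add' ψ φ := by
    rw [← MemLp.toLp_add]
    exact MemLp.toLp_congr _ _ (potentialMul_add A ψ φ)
  map_smul' c ψ := by
    rw [RingHom.id_apply, ← MemLp.toLp_const_smul]
    exact MemLp.toLp_congr _ _ (potentialMul_smul A c ψ)

/-- The Dirac Hamilton operator `α·(-iε∇ - A) + β - A₀ I₄`, as an unbounded operator in
`L²(ℝ³, ℂ⁴)` whose domain consists of all `ψ ∈ H¹(ℝ³, ℂ⁴)` for which the potential term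
`(α·A + A₀ I₄) ψ` lies in `L²(ℝ³, ℂ⁴)`. -/
def diracHamiltonian (ε : ℝ) (A : Fin 4 → Space → ℝ) : SpinorL2 →ₗ.[ℂ] SpinorL2 where
  domain := diracDomain A
  toFun := freeDirac ε ∘ₗ Submodule.inclusion (diracDomain_le A) - potentialOp A

/-- A unitary propagator: a two-parameter family of unitary operators `U t s` that satisfies
`U s s = 1` and `U t s U s u = U t u` and is jointly strongly continuous in `(t, s)`. -/
structure IsUnitaryPropagator (U : ℝ → ℝ → SpinorL2 ≃ₗᵢ[ℂ] SpinorL2) : Prop where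
  refl : ∀ s ψ, U s s ψ = ψ
  comp : ∀ t s u ψ, U t s (U s u ψ) = U t u ψ
  continuous : ∀ ψ, Continuous fun p : ℝ × ℝ => U p.1 p.2 ψ

end DiracEvolution

end

section

open Filter Topology

namespace DiracEvolution

section Dyson

variable {𝔸 : Type*} [NormedRing 𝔸] [NormedSpace ℝ 𝔸]

/-- The terms of the Dyson series of the linear equation `Φ' = A Φ`, `Φ s = 1`. -/
noncomputable def dysonTerm (A : ℝ → 𝔸) (s : ℝ) : ℕ → ℝ → 𝔸
  | 0 => fun _ => 1
  | k + 1 => fun t => ∫ τ in s..t, A τ * dysonTerm A s k τ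

theorem continuous_dysonTerm [CompleteSpace 𝔸] {A : ℝ → 𝔸} (hA : Continuous A) (s : ℝ) (k : ℕ) :
    Continuous (dysonTerm A s k) := by
  induction k with
  | zero => exact continuous_const
  | succ k ih =>
    exact intervalIntegral.continuous_primitive
      (fun a b => (hA.mul ih).intervalIntegrable a b) s

theorem hasDerivAt_dysonTerm_succ [CompleteSpace 𝔸] {A : ℝ → 𝔸} (hA : Continuous A)
    (s : ℝ) (k : ℕ) (t : ℝ) :
    HasDerivAt (dysonTerm A s (k + 1)) (A t * dysonTerm A s k t) t :=
  intervalIntegral.integral_hasDerivAt_right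
    ((hA.mul (continuous_dysonTerm hA s k)).intervalIntegrable _ _)
    ((hA.mul (continuous_dysonTerm hA s k)).stronglyMeasurableAtFilter _ _)
    (hA.mul (continuous_dysonTerm hA s k)).continuousAt

theorem norm_dysonTerm_le [CompleteSpace 𝔸] {A : ℝ → 𝔸} (hA : Continuous A) {s T M : ℝ}
    (hM : ∀ t, |t - s| ≤ T → ‖A t‖ ≤ M) (k : ℕ) {t : ℝ} (ht : |t - s| ≤ T) :
    ‖dysonTerm A s k t‖ ≤ ‖(1 : 𝔸)‖ * ((M * |t - s|) ^ k / k.factorial) := by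
  have hM0 : 0 ≤ M := (norm_nonneg _).trans (hM t ht)
  induction k generalizing t with
  | zero => simp [dysonTerm]
  | succ k ih =>
    have hcont : Continuous fun τ => A τ * dysonTerm A s k τ :=
      hA.mul (continuous_dysonTerm hA s k)
    calc ‖dysonTerm A s (k + 1) t‖
        ≤ ∫ τ in Set.uIoc s t, ‖A τ * dysonTerm A s k τ‖ :=
          intervalIntegral.norm_integral_le_integral_norm_uIoc
      _ ≤ ∫ τ in Set.uIoc s t, ‖(1 : 𝔸)‖ * M ^ (k + 1) / k.factorial * |τ - s| ^ k := by
          refine setIntegral_mono_on ?_ ?_ measurableSet_uIoc ?_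
          · exact (intervalIntegrable_iff.mp (hcont.norm.intervalIntegrable s t))
          · refine (intervalIntegrable_iff.mp (Continuous.intervalIntegrable ?_ s t))
            fun_prop
          · intro τ hτ
            have h1 : |τ - s| ≤ |t - s| := by
              rcases le_total s t with h | h
              · rw [Set.uIoc_of_le h] at hτ
                rw [abs_of_nonneg (by linarith [hτ.1]), abs_of_nonneg (by linarith)]
                linarith [hτ.2]
              · rw [Set.uIoc_of_ge h] at hτ
                rw [abs_of_nonpos (by linarith [hτ.2]), abs_of_nonpos (by linarith)]
                linarith [hτ.1]
            have h2 := ih (h1.trans ht)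
            calc ‖A τ * dysonTerm A s k τ‖ ≤ ‖A τ‖ * ‖dysonTerm A s k τ‖ := norm_mul_le _ _
              _ ≤ M * (‖(1 : 𝔸)‖ * ((M * |τ - s|) ^ k / k.factorial)) := by
                  gcongr
                  exact hM τ (h1.trans ht)
              _ = _ := by rw [mul_pow]; ring
      _ = ‖(1 : 𝔸)‖ * ((M * |t - s|) ^ (k + 1) / (k + 1).factorial) := by
          rw [integral_const_mul, integral_pow_abs_sub_uIoc, Nat.factorial_succ, mul_pow]
          push_cast
          field_simp

/-- The linear equation `Φ' = A Φ`, `Φ s = 1`, has a global solution. -/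
theorem exists_hasDerivAt_mul [CompleteSpace 𝔸] {A : ℝ → 𝔸} (hA : Continuous A) (s : ℝ) :
    ∃ Φ : ℝ → 𝔸, Φ s = 1 ∧ ∀ t, HasDerivAt Φ (A t * Φ t) t := by
  have hbound (T : ℝ) : ∃ M, ∀ t, |t - s| ≤ T → ‖A t‖ ≤ M := by
    obtain ⟨M, hM⟩ := (isCompact_closedBall s T).exists_bound_of_continuousOn hA.continuousOn
    exact ⟨M, fun t ht => hM t (by rwa [Metric.mem_closedBall, Real.dist_eq])⟩
  have hs : ∀ k, dysonTerm A s (k + 1) s = 0 := fun k => by simp [dysonTerm]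
  have hsummable (t : ℝ) : Summable fun k => dysonTerm A s k t := by
    obtain ⟨M, hM⟩ := hbound |t - s|
    exact .of_norm_bounded ((Real.summable_pow_div_factorial _).mul_left _)
      fun k => norm_dysonTerm_le hA hM k le_rfl
  refine ⟨fun t => ∑' k, dysonTerm A s k t, ?_, fun t => ?_⟩
  · beta_reduce
    rw [tsum_eq_single 0]
    · rfl
    · intro k hk
      obtain ⟨j, rfl⟩ := Nat.exists_eq_succ_of_ne_zero hk
      exact hs j
  · have h1 : (fun t => ∑' k, dysonTerm A s k t) =
        fun t => (1 : 𝔸) + ∑' k, dysonTerm A s (k + 1) t :=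
      funext fun t => (hsummable t).tsum_eq_zero_add
    rw [h1]
    obtain ⟨M, hM⟩ := hbound (|t - s| + 1)
    have hM0 : 0 ≤ M := (norm_nonneg _).trans (hM t (by linarith))
    have h2 := hasDerivAt_tsum_of_isPreconnected (𝕜 := ℝ) (t := Metric.ball s (|t - s| + 1))
      (g := fun k => dysonTerm A s (k + 1)) (g' := fun k t => A t * dysonTerm A s k t)
      (u := fun k => M * (‖(1 : 𝔸)‖ * ((M * (|t - s| + 1)) ^ k / k.factorial))) (y₀ := s) (y := t)
      (((Real.summable_pow_div_factorial _).mul_left _).mul_left _) Metric.isOpen_ball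
      (convex_ball _ _).isPreconnected (fun k y _ => hasDerivAt_dysonTerm_succ hA s k y)
      (fun k y hy => by
        have hy' : |y - s| ≤ |t - s| + 1 := by
          rw [Metric.mem_ball, Real.dist_eq] at hy
          exact hy.le
        refine (norm_mul_le _ _).trans ?_
        have h3 := norm_dysonTerm_le hA hM k hy'
        refine mul_le_mul (hM y hy') (h3.trans ?_) (norm_nonneg _) hM0
        gcongr)
      (by rw [Metric.mem_ball, dist_self]; positivity)
      (by simp only [hs]; exact summable_zero)
      (by rw [Metric.mem_ball, Real.dist_eq]; linarith)
    rw [(hsummable t).tsum_mul_left] at h2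
    have h3 : (1 : 𝔸) + ∑' k, dysonTerm A s (k + 1) t = ∑' k, dysonTerm A s k t :=
      ((hsummable t).tsum_eq_zero_add).symm
    beta_reduce
    rw [h3]
    exact h2.const_add 1

end Dyson

section BoundedGenerator

variable {H : Type*} [NormedAddCommGroup H] [InnerProductSpace ℂ H]

/-- A solution of `i u' = A u` with symmetric `A` has constant norm. -/
theorem norm_eq_of_hasDerivAt_of_symmetric {A : ℝ → H →L[ℂ] H}
    (hA : ∀ t x y, inner ℂ (A t x) y = inner ℂ x (A t y)) {u : ℝ → H}
    (hu : ∀ t, HasDerivAt u (-(Complex.I • A t (u t))) t) (t s : ℝ) : ‖u t‖ = ‖u s‖ := by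
  have h : ∀ t, HasDerivAt (fun t => inner ℂ (u t) (u t)) 0 t := by
    intro t
    convert! (hu t).inner ℂ (hu t) using 1
    rw [inner_neg_left, inner_neg_right, inner_smul_left, inner_smul_right, hA,
      Complex.conj_I]
    ring
  have h2 := is_const_of_deriv_eq_zero (fun t => (h t).differentiableAt)
    (fun t => (h t).deriv) t s
  simp only [inner_self_eq_norm_sq_to_K] at h2
  have h3 : ‖u t‖ ^ 2 = ‖u s‖ ^ 2 := by exact_mod_cast h2
  exact (sq_eq_sq₀ (norm_nonneg _) (norm_nonneg _)).mp h3

/-- The properties of the propagator of `i u' = A u` for bounded symmetric operators `A t`. -/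
structure IsBoundedPropagator (A : ℝ → H →L[ℂ] H) (U : ℝ → ℝ → H →L[ℂ] H) : Prop where
  refl : ∀ s, U s s = 1
  hasDerivAt : ∀ t s, HasDerivAt (fun τ => U τ s) (-(Complex.I • (A t * U t s))) t
  norm_map : ∀ t s x, ‖U t s x‖ = ‖x‖
  comp : ∀ t s u, U t s * U s u = U t u

theorem exists_isBoundedPropagator [CompleteSpace H] {A : ℝ → H →L[ℂ] H} (hc : Continuous A)
    (hA : ∀ t x y, inner ℂ (A t x) y = inner ℂ x (A t y)) :
    ∃ U, IsBoundedPropagator A U := by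
  choose U hU0 hU using fun s => exists_hasDerivAt_mul (hc.const_smul (-Complex.I)) s
  have hd : ∀ t s, HasDerivAt (U s) (-(Complex.I • (A t * U s t))) t := by
    intro t s
    convert! hU s t using 1
    simp
  have hdx : ∀ s x t, HasDerivAt (fun t => U s t x) (-(Complex.I • A t (U s t x))) t := by
    intro s x t
    exact ((ContinuousLinearMap.apply ℂ H x).restrictScalars ℝ).hasFDerivAt.comp_hasDerivAt t
      (hd t s)
  have hnorm : ∀ s x t, ‖U s t x‖ = ‖x‖ := by
    intro s x t
    have := norm_eq_of_hasDerivAt_of_symmetric hA (hdx s x) t s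
    simpa [hU0] using this
  refine ⟨fun t s => U s t, hU0, hd, fun t s x => hnorm s x t, fun t s u => ?_⟩
  ext x
  have h : ∀ τ, HasDerivAt (fun τ => U s τ (U u s x) - U u τ x)
      (-(Complex.I • A τ (U s τ (U u s x) - U u τ x))) τ := by
    intro τ
    convert! (hdx s (U u s x) τ).sub (hdx u x τ) using 1
    rw [map_sub, smul_sub]
    abel
  have h2 := norm_eq_of_hasDerivAt_of_symmetric hA h t s
  rw [hU0] at h2
  simpa [sub_eq_zero] using h2

theorem IsBoundedPropagator.hasDerivAt_apply {A : ℝ → H →L[ℂ] H} {U : ℝ → ℝ → H →L[ℂ] H}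
    (hU : IsBoundedPropagator A U) (s t : ℝ) (x : H) :
    HasDerivAt (fun τ => U τ s x) (-(Complex.I • A t (U t s x))) t :=
  ((ContinuousLinearMap.apply ℂ H x).restrictScalars ℝ).hasFDerivAt.comp_hasDerivAt t
    (hU.hasDerivAt t s)

theorem IsBoundedPropagator.apply_apply {A : ℝ → H →L[ℂ] H} {U : ℝ → ℝ → H →L[ℂ] H}
    (hU : IsBoundedPropagator A U) (t s u : ℝ) (x : H) : U t s (U s u x) = U t u x :=
  DFunLike.congr_fun (hU.comp t s u) x

theorem IsBoundedPropagator.star_eq [CompleteSpace H] {A : ℝ → H →L[ℂ] H}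
    {U : ℝ → ℝ → H →L[ℂ] H} (hU : IsBoundedPropagator A U) (t s : ℝ) :
    star (U t s) = U s t := by
  have h : star (U t s) * U t s = 1 :=
    (ContinuousLinearMap.norm_map_iff_adjoint_comp_self (U t s)).mp (hU.norm_map t s)
  calc star (U t s) = star (U t s) * (U t s * U s t) := by rw [hU.comp, hU.refl, mul_one]
    _ = U s t := by rw [← mul_assoc, h, one_mul]

/-- Conjugating the generator by the propagator leaves only the derivative of the generator. -/
theorem IsBoundedPropagator.hasDerivAt_conj [CompleteSpace H] {A : ℝ → H →L[ℂ] H}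
    {U : ℝ → ℝ → H →L[ℂ] H} (hU : IsBoundedPropagator A U)
    (hA : ∀ t, star (A t) = A t) {A' : H →L[ℂ] H} {t : ℝ} (hA' : HasDerivAt A A' t) (s : ℝ) :
    HasDerivAt (fun τ => U s τ * A τ * U τ s) (U s t * A' * U t s) t := by
  have h := ((hU.hasDerivAt t s).star.mul hA').mul (hU.hasDerivAt t s)
  simp only [hU.star_eq] at h
  convert! h using 1
  rw [star_neg, star_smul, star_mul, hU.star_eq, hA]
  simp only [Complex.star_def, Complex.conj_I, neg_smul, neg_neg]
  simp only [Pi.mul_apply, add_mul, smul_mul_assoc, mul_neg, mul_smul_comm, mul_assoc]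
  abel

end BoundedGenerator

/-- Grönwall's inequality in both time directions. -/
theorem norm_le_gronwallBound_of_abs_sub_le {E : Type*} [NormedAddCommGroup E] [NormedSpace ℝ E]
    {f f' : ℝ → E} {δ K ε s T : ℝ} (hf : ∀ t, |t - s| ≤ T → HasDerivAt f (f' t) t)
    (hs : ‖f s‖ ≤ δ) (hK : 0 ≤ K) (hε : 0 ≤ ε)
    (bound : ∀ t, |t - s| ≤ T → ‖f' t‖ ≤ K * ‖f t‖ + ε) {t : ℝ} (ht : |t - s| ≤ T) :
    ‖f t‖ ≤ gronwallBound δ K ε T := by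
  have key : ∀ g g' : ℝ → E, (∀ x ∈ Set.Icc 0 T, HasDerivAt g (g' x) x) → ‖g 0‖ ≤ δ →
      (∀ x ∈ Set.Icc 0 T, ‖g' x‖ ≤ K * ‖g x‖ + ε) → ∀ x ∈ Set.Icc 0 T,
        ‖g x‖ ≤ gronwallBound δ K ε T := by
    intro g g' hg h0 hb x hx
    have h1 := norm_le_gronwallBound_of_norm_deriv_right_le (f := g) (f' := g') (a := 0) (b := T)
      (fun y hy => (hg y hy).continuousAt.continuousWithinAt)
      (fun y hy => (hg y (Set.Ico_subset_Icc_self hy)).hasDerivWithinAt) h0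
      (fun y hy => hb y (Set.Ico_subset_Icc_self hy)) x hx
    rw [sub_zero] at h1
    exact h1.trans (gronwallBound_mono ((norm_nonneg _).trans hs) hε hK hx.2)
  rcases le_total s t with h | h
  · have h1 := key (fun x => f (s + x)) (fun x => f' (s + x))
      (fun x hx => (hf (s + x) (by simpa [abs_of_nonneg hx.1] using hx.2)).comp_const_add s x)
      (by simpa using hs)
      (fun x hx => bound _ (by simpa [abs_of_nonneg hx.1] using hx.2)) (t - s)
      ⟨by linarith, by rwa [abs_of_nonneg (by linarith)] at ht⟩
    simpa using h1
  · have h1 := key (fun x => f (s - x)) (fun x => -f' (s - x))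
      (fun x hx => (hf (s - x) (by simpa [abs_of_nonneg hx.1] using hx.2)).comp_const_sub s x)
      (by simpa using hs)
      (fun x hx => by
        rw [norm_neg]
        exact bound _ (by simpa [abs_of_nonneg hx.1] using hx.2)) (s - t)
      ⟨by linarith, by rw [abs_of_nonpos (by linarith)] at ht; linarith⟩
    simpa using h1

/-- The mean value inequality on a symmetric interval. -/
theorem norm_sub_le_of_abs_sub_le {E : Type*} [NormedAddCommGroup E] [NormedSpace ℝ E]
    {f f' : ℝ → E} {C s T : ℝ} (hf : ∀ t, |t - s| ≤ T → HasDerivAt f (f' t) t)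
    (bound : ∀ t, |t - s| ≤ T → ‖f' t‖ ≤ C) {t : ℝ} (ht : |t - s| ≤ T) :
    ‖f t - f s‖ ≤ C * |t - s| := by
  have hT : 0 ≤ T := (abs_nonneg _).trans ht
  have hmem : ∀ x, x ∈ Metric.closedBall s T ↔ |x - s| ≤ T := fun x => by
    rw [Metric.mem_closedBall, Real.dist_eq]
  exact (convex_closedBall s T).norm_image_sub_le_of_norm_hasDerivWithin_le
    (fun x hx => (hf x ((hmem x).mp hx)).hasDerivWithinAt)
    (fun x hx => bound x ((hmem x).mp hx)) (Metric.mem_closedBall_self hT) ((hmem t).mpr ht)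

section Galerkin

variable {H : Type*} [NormedAddCommGroup H] [InnerProductSpace ℂ H]

/-- Data for solving `i u' = 𝓗(t) u` by Galerkin approximation, where the operators `𝓗(t)` have the
common domain `range R` and `𝓗(t) R = G t` is bounded. The `P n` are increasing orthogonal
projections that commute with `R`, and `K n` inverts `R` on the range of `P n`. -/
structure GalerkinScheme (R : H →L[ℂ] H) (P K : ℕ → H →L[ℂ] H) (G : ℝ → H →L[ℂ] H) : Prop where
  denseRange : DenseRange R
  symm_P : ∀ n x y, inner ℂ (P n x) y = inner ℂ x (P n y)
  P_P : ∀ {n m}, n ≤ m → ∀ x, P m (P n x) = P n x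
  R_K : ∀ n x, R (K n x) = P n x
  K_R : ∀ n x, K n (R x) = P n x
  P_K : ∀ n x, P n (K n x) = K n x
  tendsto_P : ∀ x, Tendsto (fun n => P n x) atTop (𝓝 x)
  tendsto_P_R : Tendsto (fun n => ‖(1 - P n) * R‖) atTop (𝓝 0)
  contDiff_G : ContDiff ℝ 1 G
  symm_G : ∀ t x y, inner ℂ (R x) (G t y) = inner ℂ (G t x) (R y)
  coercive : ∀ T, ∃ c, 0 ≤ c ∧ ∀ t, |t| ≤ T → ∀ n x, P n x = x →
    ‖x‖ ≤ c * (‖P n (G t x)‖ + ‖R x‖)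

namespace GalerkinScheme

variable {R : H →L[ℂ] H} {P K : ℕ → H →L[ℂ] H} {G : ℝ → H →L[ℂ] H}

theorem K_P (S : GalerkinScheme R P K G) (n : ℕ) (x : H) : K n (P n x) = K n x := by
  rw [← S.R_K, S.K_R, S.P_K]

theorem P_R (S : GalerkinScheme R P K G) (n : ℕ) (x : H) : P n (R x) = R (P n x) := by
  rw [← S.R_K, S.K_R]

theorem P_P' (S : GalerkinScheme R P K G) {n m : ℕ} (h : n ≤ m) (x : H) :
    P n (P m x) = P n x := by
  refine ext_inner_right ℂ fun y => ?_
  rw [S.symm_P, S.symm_P, S.P_P h, S.symm_P]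

theorem norm_P_le (S : GalerkinScheme R P K G) (n : ℕ) (x : H) : ‖P n x‖ ≤ ‖x‖ := by
  have h1 : ‖P n x‖ ^ 2 ≤ ‖x‖ * ‖P n x‖ := by
    have h2 : inner ℂ (P n x) (P n x) = inner ℂ x (P n x) := by
      rw [S.symm_P, S.P_P le_rfl]
    have h3 : ‖inner ℂ (P n x) (P n x)‖ ≤ ‖x‖ * ‖P n x‖ := h2 ▸ norm_inner_le_norm x (P n x)
    rwa [inner_self_eq_norm_sq_to_K, norm_pow, RCLike.norm_ofReal, abs_norm] at h3
  rcases (norm_nonneg (P n x)).eq_or_lt with h | h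
  · rw [← h]; exact norm_nonneg _
  · rw [sq] at h1
    exact le_of_mul_le_mul_right h1 h

theorem symm_generator (S : GalerkinScheme R P K G) (n : ℕ) (t : ℝ) (x y : H) :
    inner ℂ ((P n * G t * K n) x) y = inner ℂ x ((P n * G t * K n) y) := by
  simp only [mul_apply_eq_comp]
  rw [S.symm_P, ← S.R_K, ← S.symm_G, S.R_K, S.symm_P]

theorem continuous_G (S : GalerkinScheme R P K G) : Continuous G := S.contDiff_G.continuous

theorem continuous_generator (S : GalerkinScheme R P K G) (n : ℕ) :
    Continuous fun t => P n * G t * K n :=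
  (continuous_const.mul S.continuous_G).mul continuous_const

theorem hasDerivAt_G (S : GalerkinScheme R P K G) (t : ℝ) : HasDerivAt G (deriv G t) t :=
  (S.contDiff_G.differentiable one_ne_zero t).hasDerivAt

theorem exists_norm_le {E : Type*} [NormedAddCommGroup E] {F : ℝ → E} (hF : Continuous F)
    (s T : ℝ) : ∃ C, 0 ≤ C ∧ ∀ t, |t - s| ≤ T → ‖F t‖ ≤ C := by
  obtain ⟨C, hC⟩ := (isCompact_closedBall s T).exists_bound_of_continuousOn hF.continuousOn
  exact ⟨max C 0, le_max_right _ _, fun t ht =>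
    (hC t (by rwa [Metric.mem_closedBall, Real.dist_eq])).trans (le_max_left _ _)⟩

variable {U : ℕ → ℝ → ℝ → H →L[ℂ] H}

/-- The Galerkin approximations stay in the range of the projections. -/
theorem P_apply_eq (S : GalerkinScheme R P K G)
    (hU : ∀ n, IsBoundedPropagator (fun t => P n * G t * K n) (U n)) (n : ℕ) (t s : ℝ) (x : H) :
    P n (U n t s (P n x)) = U n t s (P n x) := by
  have h : ∀ τ, HasDerivAt (fun τ => P n (U n τ s (P n x)) - U n τ s (P n x)) 0 τ := by
    intro τ
    have h1 := (hU n).hasDerivAt_apply s τ (P n x)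
    have h2 := ((P n).restrictScalars ℝ).hasFDerivAt.comp_hasDerivAt τ h1
    convert! h2.sub h1 using 1
    simp [S.P_P le_rfl]
  have h2 := is_const_of_deriv_eq_zero (fun t => (h t).differentiableAt)
    (fun t => (h t).deriv) t s
  simpa [(hU n).refl, S.P_P le_rfl, sub_eq_zero] using h2

theorem R_K_apply_eq (S : GalerkinScheme R P K G)
    (hU : ∀ n, IsBoundedPropagator (fun t => P n * G t * K n) (U n)) (n : ℕ) (t s : ℝ) (x : H) :
    R (K n (U n t s (P n x))) = U n t s (P n x) := by
  rw [S.R_K, S.P_apply_eq hU]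

/-- Bounds in the graph norm that are uniform in the approximation. -/
theorem exists_uniform_bound [CompleteSpace H] (S : GalerkinScheme R P K G)
    (hU : ∀ n, IsBoundedPropagator (fun t => P n * G t * K n) (U n)) (s T : ℝ) (x : H) :
    ∃ C, 0 ≤ C ∧ ∀ n t, |t - s| ≤ T → ‖K n (U n t s (P n (R x)))‖ ≤ C ∧
      ‖P n (G t (K n (U n t s (P n (R x))))) - U n t s (P n (G s (P n x)))‖ ≤ C * |t - s| := by
  obtain ⟨c, hc0, hc⟩ := S.coercive (|s| + T)
  obtain ⟨g, hg0, hg⟩ := exists_norm_le (S.contDiff_G.continuous_deriv le_rfl) s T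
  have hsT : ∀ t, |t - s| ≤ T → |t| ≤ |s| + T := by
    intro t ht
    have h : |t| ≤ |t - s| + |s| := by simpa using abs_add_le (t - s) s
    linarith
  set B := gronwallBound (‖G s‖ * ‖x‖) (g * c) (g * c * ‖R x‖) T with hB
  set D := c * (B + ‖R x‖)
  refine ⟨max 0 (max D (g * D)), le_max_left _ _, fun n => ?_⟩
  set V : ℝ → H := fun t => (U n s t * (P n * G t * K n) * U n t s) (P n (R x)) with hV
  have hself : ∀ t, star (P n * G t * K n) = P n * G t * K n := fun t =>
    ((ContinuousLinearMap.isSelfAdjoint_iff_isSymmetric).mpr (S.symm_generator n t))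
  have hVd : ∀ t, HasDerivAt V
      ((U n s t * (P n * deriv G t * K n) * U n t s) (P n (R x))) t := by
    intro t
    have h1 : HasDerivAt (fun t => P n * G t * K n) (P n * deriv G t * K n) t :=
      ((S.hasDerivAt_G t).const_mul (P n)).mul_const (K n)
    exact ((ContinuousLinearMap.apply ℂ H (P n (R x))).restrictScalars
      ℝ).hasFDerivAt.comp_hasDerivAt t ((hU n).hasDerivAt_conj hself h1 s)
  have hVnorm : ∀ t, ‖V t‖ = ‖P n (G t (K n (U n t s (P n (R x)))))‖ := fun t =>
    (hU n).norm_map s t _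
  have hVs : V s = P n (G s (P n x)) := by
    simp [hV, (hU n).refl, S.K_P, S.K_R]
  have hV0 : ‖V s‖ ≤ ‖G s‖ * ‖x‖ := by
    rw [hVs]
    exact (S.norm_P_le _ _).trans (((G s).le_opNorm _).trans
      (mul_le_mul_of_nonneg_left (S.norm_P_le _ _) (norm_nonneg _)))
  have hy : ∀ t, |t - s| ≤ T → ‖K n (U n t s (P n (R x)))‖ ≤ c * (‖V t‖ + ‖R x‖) := by
    intro t ht
    have h1 := hc t (hsT t ht) n (K n (U n t s (P n (R x)))) (S.P_K _ _)
    rw [← hVnorm, S.R_K_apply_eq hU, (hU n).norm_map] at h1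
    refine h1.trans ?_
    gcongr
    exact S.norm_P_le _ _
  have hd : ∀ t, |t - s| ≤ T →
      ‖(U n s t * (P n * deriv G t * K n) * U n t s) (P n (R x))‖ ≤
        g * ‖K n (U n t s (P n (R x)))‖ := by
    intro t ht
    simp only [mul_apply_eq_comp]
    rw [(hU n).norm_map]
    refine (S.norm_P_le _ _).trans (((deriv G t).le_opNorm _).trans ?_)
    gcongr
    exact hg t ht
  have hVB : ∀ t, |t - s| ≤ T → ‖V t‖ ≤ B := fun t ht =>
    norm_le_gronwallBound_of_abs_sub_le (fun t _ => hVd t) hV0 (by positivity) (by positivity)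
      (fun t ht => (hd t ht).trans (by
        calc g * ‖K n (U n t s (P n (R x)))‖ ≤ g * (c * (‖V t‖ + ‖R x‖)) := by
              gcongr; exact hy t ht
          _ = _ := by ring)) ht
  have hyD : ∀ t, |t - s| ≤ T → ‖K n (U n t s (P n (R x)))‖ ≤ D := fun t ht =>
    (hy t ht).trans (mul_le_mul_of_nonneg_left (by linarith [hVB t ht]) hc0)
  intro t ht
  refine ⟨(hyD t ht).trans ((le_max_left _ _).trans (le_max_right _ _)), ?_⟩
  have h1 := norm_sub_le_of_abs_sub_le (fun t _ => hVd t)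
    (fun t ht => (hd t ht).trans (mul_le_mul_of_nonneg_left (hyD t ht) hg0)) ht
  have h2 : P n (G t (K n (U n t s (P n (R x))))) - U n t s (P n (G s (P n x))) =
      U n t s (V t - V s) := by
    rw [map_sub, hVs]
    simp only [hV, mul_apply_eq_comp]
    rw [(hU n).apply_apply, (hU n).refl, one_apply_eq_self]
  rw [h2, (hU n).norm_map]
  refine h1.trans ?_
  gcongr
  exact (le_max_right _ _).trans (le_max_right _ _)

theorem re_I_mul_inner_sub_le (S : GalerkinScheme R P K G) {n m : ℕ} (hnm : n ≤ m) (t : ℝ)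
    {y z : H} (hy : P n y = y) (hz : P m z = z) :
    |(inner ℂ (R y - R z) (-(Complex.I • (P n (G t y) - P m (G t z))))).re| ≤
      ‖(1 - P n) * R‖ * ‖z‖ * (‖G t‖ * ‖y‖) := by
  have e1 : inner ℂ (R y - R z) (P n (G t y)) =
      inner ℂ (R y) (G t y) - inner ℂ (R z) (G t y) + inner ℂ (((1 - P n) * R) z) (G t y) := by
    rw [← S.symm_P, map_sub, S.P_R, hy]
    simp only [mul_apply_eq_comp, sub_apply,
      one_apply_eq_self, inner_sub_left]
    ring
  have e2 : inner ℂ (R y - R z) (P m (G t z)) =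
      inner ℂ (R y) (G t z) - inner ℂ (R z) (G t z) := by
    have hy' : P m y = y := by rw [← hy, S.P_P hnm]
    rw [← S.symm_P, map_sub, S.P_R, S.P_R, hy', hz, inner_sub_left]
  have him : ∀ v, (inner ℂ (R v) (G t v)).im = 0 := by
    intro v
    have h := S.symm_G t v v
    rw [← inner_conj_symm (G t v)] at h
    exact Complex.conj_eq_iff_im.mp h.symm
  have him2 : (inner ℂ (R z) (G t y)).im = -(inner ℂ (R y) (G t z)).im := by
    rw [S.symm_G, ← inner_conj_symm, Complex.conj_im]
  have e3 : (inner ℂ (R y - R z) (-(Complex.I • (P n (G t y) - P m (G t z))))).re =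
      (inner ℂ (((1 - P n) * R) z) (G t y)).im := by
    rw [inner_neg_right, inner_smul_right, inner_sub_right, e1, e2]
    simp only [Complex.neg_re, Complex.mul_re, Complex.I_re, Complex.I_im, Complex.sub_im,
      Complex.add_im, him, him2]
    ring
  rw [e3]
  calc |(inner ℂ (((1 - P n) * R) z) (G t y)).im|
      ≤ ‖inner ℂ (((1 - P n) * R) z) (G t y)‖ := Complex.abs_im_le_norm _
    _ ≤ ‖((1 - P n) * R) z‖ * ‖G t y‖ := norm_inner_le_norm _ _
    _ ≤ _ := by
        gcongr
        · exact ContinuousLinearMap.le_opNorm _ _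
        · exact ContinuousLinearMap.le_opNorm _ _

theorem exists_norm_sq_sub_le [CompleteSpace H] (S : GalerkinScheme R P K G)
    (hU : ∀ n, IsBoundedPropagator (fun t => P n * G t * K n) (U n)) (s T : ℝ) (x : H) :
    ∃ C, 0 ≤ C ∧ ∀ n m, n ≤ m → ∀ t, |t - s| ≤ T →
      ‖U n t s (P n (R x)) - U m t s (P m (R x))‖ ^ 2 ≤
        ‖P n (R x) - P m (R x)‖ ^ 2 + C * ‖(1 - P n) * R‖ := by
  obtain ⟨C, hC0, hC⟩ := S.exists_uniform_bound hU s T x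
  obtain ⟨g, hg0, hg⟩ := exists_norm_le S.continuous_G s T
  refine ⟨2 * (C * (g * C)) * |T|, by positivity, fun n m hnm t ht => ?_⟩
  set y : ℝ → H := fun t => K n (U n t s (P n (R x))) with hy
  set z : ℝ → H := fun t => K m (U m t s (P m (R x))) with hz
  set e : ℝ → H := fun t => U n t s (P n (R x)) - U m t s (P m (R x)) with he
  have hed : ∀ t, HasDerivAt e (-(Complex.I • (P n (G t (y t)) - P m (G t (z t))))) t := by
    intro t
    convert! ((hU n).hasDerivAt_apply s t (P n (R x))).sub
      ((hU m).hasDerivAt_apply s t (P m (R x))) using 1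
    simp only [mul_apply_eq_comp, hy, hz, smul_sub]
    abel
  have heq : ∀ t, e t = R (y t) - R (z t) := by
    intro t
    simp only [hy, hz, he, S.R_K_apply_eq hU]
  have hnd : ∀ t, HasDerivAt (fun t => ‖e t‖ ^ 2)
      (2 * (inner ℂ (e t) (-(Complex.I • (P n (G t (y t)) - P m (G t (z t)))))).re) t := by
    intro t
    have h1 := (hed t).inner ℂ (hed t)
    have h2 := Complex.reCLM.hasFDerivAt.comp_hasDerivAt t h1
    convert! h2 using 1
    · funext τ
      simp only [Function.comp, inner_self_eq_norm_sq_to_K]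
      norm_cast
    · rw [← inner_conj_symm _ (e t)]
      simp only [Complex.reCLM_apply, Complex.add_re, Complex.conj_re]
      ring
  have hb : ∀ t, |t - s| ≤ T →
      ‖2 * (inner ℂ (e t) (-(Complex.I • (P n (G t (y t)) - P m (G t (z t)))))).re‖ ≤
        2 * (‖(1 - P n) * R‖ * C * (g * C)) := by
    intro t ht
    rw [norm_mul, Real.norm_two, Real.norm_eq_abs, heq]
    have h1 := S.re_I_mul_inner_sub_le hnm t (y := y t) (z := z t) (S.P_K _ _) (S.P_K _ _)
    refine mul_le_mul_of_nonneg_left (h1.trans ?_) zero_le_two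
    gcongr
    · exact (hC m t ht).1
    · exact hg t ht
    · exact (hC n t ht).1
  have h1 := norm_sub_le_of_abs_sub_le (fun t _ => hnd t) hb ht
  have h2 : ‖e s‖ = ‖P n (R x) - P m (R x)‖ := by simp [he, (hU _).refl]
  rw [Real.norm_eq_abs, h2] at h1
  have h3 : |t - s| ≤ |T| := ht.trans (le_abs_self T)
  have h4 := (le_abs_self _).trans h1
  have h5 : 2 * (‖(1 - P n) * R‖ * C * (g * C)) * |t - s| ≤
      2 * (‖(1 - P n) * R‖ * C * (g * C)) * |T| := by gcongr
  calc ‖e t‖ ^ 2 ≤ ‖P n (R x) - P m (R x)‖ ^ 2 +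
        2 * (‖(1 - P n) * R‖ * C * (g * C)) * |T| := by linarith
    _ = _ := by ring

end GalerkinScheme

end Galerkin

section Galerkin

variable {H : Type*} [NormedAddCommGroup H] [InnerProductSpace ℂ H]

namespace GalerkinScheme

variable {R : H →L[ℂ] H} {P K : ℕ → H →L[ℂ] H} {G : ℝ → H →L[ℂ] H}
  {U : ℕ → ℝ → ℝ → H →L[ℂ] H}

theorem norm_map_sub
    (hU : ∀ n, IsBoundedPropagator (fun t => P n * G t * K n) (U n)) (n : ℕ) (t s : ℝ) (x y : H) :
    ‖U n t s x - U n t s y‖ = ‖x - y‖ := by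
  rw [← map_sub, (hU n).norm_map]

theorem uniformCauchy_range [CompleteSpace H] (S : GalerkinScheme R P K G)
    (hU : ∀ n, IsBoundedPropagator (fun t => P n * G t * K n) (U n)) (s T : ℝ) (x : H)
    {ε : ℝ} (hε : 0 < ε) : ∃ N, ∀ n, N ≤ n → ∀ m, n ≤ m → ∀ t, |t - s| ≤ T →
      ‖U n t s (P n (R x)) - U m t s (P m (R x))‖ ≤ ε := by
  obtain ⟨C, hC0, hC⟩ := S.exists_norm_sq_sub_le hU s T x
  have h1 : Tendsto (fun n => C * ‖(1 - P n) * R‖) atTop (𝓝 0) := by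
    simpa using S.tendsto_P_R.const_mul C
  obtain ⟨N₁, hN₁⟩ := eventually_atTop.mp (h1.eventually_le_const (show 0 < ε ^ 2 / 2 by positivity))
  obtain ⟨N₂, hN₂⟩ := Metric.cauchySeq_iff.mp (S.tendsto_P (R x)).cauchySeq (ε / 2) (by positivity)
  refine ⟨max N₁ N₂, fun n hn m hnm t ht => ?_⟩
  have h2 := hC n m hnm t ht
  have h3 := hN₁ n ((le_max_left _ _).trans hn)
  have h4 := hN₂ n ((le_max_right _ _).trans hn) m ((le_max_right _ _).trans (hn.trans hnm))
  rw [dist_eq_norm] at h4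
  have h5 : ‖P n (R x) - P m (R x)‖ ^ 2 ≤ (ε / 2) ^ 2 := by gcongr
  refine le_of_sq_le_sq ?_ hε.le
  nlinarith [sq_nonneg ε]

/-- The Galerkin propagators are strongly Cauchy, locally uniformly in time. -/
theorem uniformCauchy [CompleteSpace H] (S : GalerkinScheme R P K G)
    (hU : ∀ n, IsBoundedPropagator (fun t => P n * G t * K n) (U n)) (s T : ℝ) (ψ : H)
    {ε : ℝ} (hε : 0 < ε) : ∃ N, ∀ n, N ≤ n → ∀ m, n ≤ m → ∀ t, |t - s| ≤ T →
      ‖U n t s ψ - U m t s ψ‖ ≤ ε := by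
  obtain ⟨x, hx⟩ := Metric.denseRange_iff.mp S.denseRange ψ (ε / 5) (by positivity)
  rw [dist_eq_norm] at hx
  obtain ⟨N₁, hN₁⟩ := S.uniformCauchy_range hU s T x (show 0 < ε / 5 by positivity)
  obtain ⟨N₂, hN₂⟩ := Metric.tendsto_atTop.mp (S.tendsto_P (R x)) (ε / 5) (by positivity)
  have key : ∀ n, N₂ ≤ n → ∀ t, ‖U n t s ψ - U n t s (P n (R x))‖ ≤ 2 * (ε / 5) := by
    intro n hn t
    rw [norm_map_sub hU]
    have h1 := hN₂ n hn
    rw [dist_eq_norm, norm_sub_rev] at h1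
    calc ‖ψ - P n (R x)‖ = ‖(ψ - R x) + (R x - P n (R x))‖ := by rw [sub_add_sub_cancel]
      _ ≤ ‖ψ - R x‖ + ‖R x - P n (R x)‖ := norm_add_le _ _
      _ ≤ _ := by linarith
  refine ⟨max N₁ N₂, fun n hn m hnm t ht => ?_⟩
  have h1 := key n ((le_max_right _ _).trans hn) t
  have h2 := key m ((le_max_right _ _).trans (hn.trans hnm)) t
  have h3 := hN₁ n ((le_max_left _ _).trans hn) m hnm t ht
  have h4 : U n t s ψ - U m t s ψ = (U n t s ψ - U n t s (P n (R x))) +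
      (U n t s (P n (R x)) - U m t s (P m (R x))) - (U m t s ψ - U m t s (P m (R x))) := by abel
  rw [h4]
  refine (norm_sub_le _ _).trans ((add_le_add (norm_add_le _ _) le_rfl).trans ?_)
  linarith

/-- A limit of vectors that are bounded in the graph norm lies in the range of `R`. -/
theorem mem_range_of_tendsto [CompleteSpace H] (S : GalerkinScheme R P K G) {y : ℕ → H} {C : ℝ}
    (hy : ∀ n, ‖y n‖ ≤ C) {φ : H} (hφ : Tendsto (fun n => R (y n)) atTop (𝓝 φ)) :
    ∃ z, R z = φ := by
  have hK : ∀ m, ‖K m φ‖ ≤ C := by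
    intro m
    have h1 : Tendsto (fun n => ‖K m (R (y n))‖) atTop (𝓝 ‖K m φ‖) :=
      (((K m).continuous.tendsto φ).comp hφ).norm
    refine le_of_tendsto' h1 fun n => ?_
    rw [S.K_R]
    exact (S.norm_P_le m _).trans (hy n)
  have hPK : ∀ {n m}, n ≤ m → P n (K m φ) = K n φ := by
    intro n m hnm
    have h1 : P n (K m φ) = K n (P m φ) := by rw [← S.R_K m, S.K_R]
    rw [h1, ← S.K_P, S.P_P' hnm, S.K_P]
  have hpyth : ∀ {n m}, n ≤ m → ‖K m φ - K n φ‖ ^ 2 = ‖K m φ‖ ^ 2 - ‖K n φ‖ ^ 2 := by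
    intro n m hnm
    have h1 : inner ℂ (K n φ) (K m φ) = inner ℂ (K n φ) (K n φ) := by
      rw [← hPK hnm, S.symm_P, S.symm_P, S.P_P le_rfl]
    rw [norm_sub_rev, @norm_sub_sq ℂ, h1, inner_self_eq_norm_sq_to_K]
    norm_cast
    ring
  have hmono : Monotone fun n => ‖K n φ‖ ^ 2 := by
    intro n m hnm
    have := hpyth hnm
    have h2 := sq_nonneg ‖K m φ - K n φ‖
    simp only
    linarith
  have hbdd : BddAbove (Set.range fun n => ‖K n φ‖ ^ 2) := by
    refine ⟨C ^ 2, ?_⟩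
    rintro _ ⟨n, rfl⟩
    exact pow_le_pow_left₀ (norm_nonneg _) (hK n) 2
  have hcau := (tendsto_atTop_ciSup hmono hbdd).cauchySeq
  have hcauchy : CauchySeq fun n => K n φ := by
    rw [Metric.cauchySeq_iff']
    intro ε hε
    obtain ⟨N, hN⟩ := Metric.cauchySeq_iff'.mp hcau (ε ^ 2) (by positivity)
    refine ⟨N, fun n hn => ?_⟩
    have h1 := hN n hn
    rw [Real.dist_eq, ← hpyth hn, abs_of_nonneg (by positivity)] at h1
    rw [dist_eq_norm]
    exact lt_of_pow_lt_pow_left₀ 2 hε.le h1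
  obtain ⟨z, hz⟩ := cauchySeq_tendsto_of_complete hcauchy
  refine ⟨z, tendsto_nhds_unique ((R.continuous.tendsto z).comp hz) ?_⟩
  have : (R ∘ fun n => K n φ) = fun n => P n φ := funext fun n => S.R_K n φ
  rw [this]
  exact S.tendsto_P φ

/-- The strong limit of the Galerkin propagators. -/
theorem exists_limit [CompleteSpace H] (S : GalerkinScheme R P K G)
    (hU : ∀ n, IsBoundedPropagator (fun t => P n * G t * K n) (U n)) :
    ∃ V : ℝ → ℝ → H ≃ₗᵢ[ℂ] H, (∀ s ψ, V s s ψ = ψ) ∧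
      (∀ t s u ψ, V t s (V s u ψ) = V t u ψ) ∧
      ∀ s T ψ ε, 0 < ε → ∃ N, ∀ n, N ≤ n → ∀ t, |t - s| ≤ T → ‖U n t s ψ - V t s ψ‖ ≤ ε := by
  have hcau : ∀ t s ψ, CauchySeq fun n => U n t s ψ := by
    intro t s ψ
    rw [Metric.cauchySeq_iff']
    intro ε hε
    obtain ⟨N, hN⟩ := S.uniformCauchy hU s |t - s| ψ (half_pos hε)
    refine ⟨N, fun n hn => ?_⟩
    rw [dist_comm, dist_eq_norm]
    exact (hN N le_rfl n hn t le_rfl).trans_lt (by linarith)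
  choose L hL using fun t s ψ => cauchySeq_tendsto_of_complete (hcau t s ψ)
  have hrefl : ∀ s ψ, L s s ψ = ψ := by
    intro s ψ
    refine tendsto_nhds_unique (hL s s ψ) ?_
    simp [(hU _).refl]
  have hcomp : ∀ t s u ψ, L t s (L s u ψ) = L t u ψ := by
    intro t s u ψ
    refine tendsto_nhds_unique ?_ (hL t u ψ)
    have h1 : Tendsto (fun n => U n t s (U n s u ψ) - U n t s (L s u ψ)) atTop (𝓝 0) := by
      rw [tendsto_zero_iff_norm_tendsto_zero]
      simp only [norm_map_sub hU]
      exact tendsto_iff_norm_sub_tendsto_zero.mp (hL s u ψ)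
    have h2 := h1.add (hL t s (L s u ψ))
    simpa [(hU _).apply_apply] using h2
  have hadd : ∀ t s ψ φ, L t s (ψ + φ) = L t s ψ + L t s φ := by
    intro t s ψ φ
    refine tendsto_nhds_unique (hL t s _) ?_
    simpa using (hL t s ψ).add (hL t s φ)
  have hsmul : ∀ t s (c : ℂ) ψ, L t s (c • ψ) = c • L t s ψ := by
    intro t s c ψ
    refine tendsto_nhds_unique (hL t s _) ?_
    simpa using (hL t s ψ).const_smul c
  have hnorm : ∀ t s ψ, ‖L t s ψ‖ = ‖ψ‖ := by
    intro t s ψ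
    refine tendsto_nhds_unique (hL t s ψ).norm ?_
    simp [(hU _).norm_map]
  refine ⟨fun t s =>
    { toFun := L t s
      map_add' := hadd t s
      map_smul' := hsmul t s
      invFun := L s t
      left_inv := fun ψ => by rw [hcomp, hrefl]
      right_inv := fun ψ => by rw [hcomp, hrefl]
      norm_map' := hnorm t s }, hrefl, hcomp, fun s T ψ ε hε => ?_⟩
  obtain ⟨N, hN⟩ := S.uniformCauchy hU s T ψ hε
  refine ⟨N, fun n hn t ht => ?_⟩
  have h1 : Tendsto (fun m => ‖U n t s ψ - U m t s ψ‖) atTop (𝓝 ‖U n t s ψ - L t s ψ‖) :=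
    (tendsto_const_nhds.sub (hL t s ψ)).norm
  exact le_of_tendsto h1 (eventually_atTop.mpr ⟨n, fun m hm => hN n hn m hm t ht⟩)

section Limit

variable {V : ℝ → ℝ → H ≃ₗᵢ[ℂ] H}

theorem tendsto_of_uniform (hV : ∀ s T ψ ε, 0 < ε → ∃ N, ∀ n, N ≤ n → ∀ t, |t - s| ≤ T →
      ‖U n t s ψ - V t s ψ‖ ≤ ε) (t s : ℝ) (ψ : H) :
    Tendsto (fun n => U n t s ψ) atTop (𝓝 (V t s ψ)) := by
  rw [tendsto_iff_norm_sub_tendsto_zero, Metric.tendsto_atTop]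
  intro ε hε
  obtain ⟨N, hN⟩ := hV s |t - s| ψ (ε / 2) (half_pos hε)
  refine ⟨N, fun n hn => ?_⟩
  rw [Real.dist_0_eq_abs, abs_norm]
  exact (hN n hn t le_rfl).trans_lt (by linarith)

theorem tendsto_apply_P (S : GalerkinScheme R P K G)
    (hU : ∀ n, IsBoundedPropagator (fun t => P n * G t * K n) (U n))
    (hV : ∀ s T ψ ε, 0 < ε → ∃ N, ∀ n, N ≤ n → ∀ t, |t - s| ≤ T →
      ‖U n t s ψ - V t s ψ‖ ≤ ε) (t s : ℝ) (ψ : H) :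
    Tendsto (fun n => U n t s (P n ψ)) atTop (𝓝 (V t s ψ)) := by
  have h1 : Tendsto (fun n => U n t s (P n ψ) - U n t s ψ) atTop (𝓝 0) := by
    rw [tendsto_zero_iff_norm_tendsto_zero]
    simp only [norm_map_sub hU]
    exact tendsto_iff_norm_sub_tendsto_zero.mp (S.tendsto_P ψ)
  simpa using h1.add (tendsto_of_uniform hV t s ψ)

theorem continuous_limit_left (hU : ∀ n, IsBoundedPropagator (fun t => P n * G t * K n) (U n))
    (hV : ∀ s T ψ ε, 0 < ε → ∃ N, ∀ n, N ≤ n → ∀ t, |t - s| ≤ T →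
      ‖U n t s ψ - V t s ψ‖ ≤ ε) (s : ℝ) (ψ : H) : Continuous fun t => V t s ψ := by
  rw [continuous_iff_continuousAt]
  intro t₀
  have h1 : TendstoUniformlyOn (fun n t => U n t s ψ) (fun t => V t s ψ) atTop
      (Metric.ball s (|t₀ - s| + 1)) := by
    rw [Metric.tendstoUniformlyOn_iff]
    intro ε hε
    obtain ⟨N, hN⟩ := hV s (|t₀ - s| + 1) ψ (ε / 2) (half_pos hε)
    refine eventually_atTop.mpr ⟨N, fun n hn t ht => ?_⟩
    rw [Metric.mem_ball, Real.dist_eq] at ht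
    rw [dist_comm, dist_eq_norm]
    exact (hN n hn t ht.le).trans_lt (by linarith)
  refine (h1.continuousOn (Frequently.of_forall fun n t _ =>
    ((hU n).hasDerivAt_apply s t ψ).continuousAt.continuousWithinAt)).continuousAt
      (Metric.isOpen_ball.mem_nhds ?_)
  rw [Metric.mem_ball, Real.dist_eq]
  linarith

theorem limit_mem_range [CompleteSpace H] (S : GalerkinScheme R P K G)
    (hU : ∀ n, IsBoundedPropagator (fun t => P n * G t * K n) (U n))
    (hV : ∀ s T ψ ε, 0 < ε → ∃ N, ∀ n, N ≤ n → ∀ t, |t - s| ≤ T →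
      ‖U n t s ψ - V t s ψ‖ ≤ ε) (t s : ℝ) (x : H) : ∃ z, R z = V t s (R x) := by
  obtain ⟨C, -, hC⟩ := S.exists_uniform_bound hU s |t - s| x
  refine S.mem_range_of_tendsto (fun n => (hC n t le_rfl).1) ?_
  simp only [S.R_K_apply_eq hU]
  exact S.tendsto_apply_P hU hV t s (R x)

theorem hasDerivAt_limit_self [CompleteSpace H] (S : GalerkinScheme R P K G)
    (hU : ∀ n, IsBoundedPropagator (fun t => P n * G t * K n) (U n))
    (hV0 : ∀ s ψ, V s s ψ = ψ)
    (hV : ∀ s T ψ ε, 0 < ε → ∃ N, ∀ n, N ≤ n → ∀ t, |t - s| ≤ T →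
      ‖U n t s ψ - V t s ψ‖ ≤ ε) (s : ℝ) (x : H) :
    HasDerivAt (fun t => V t s (R x)) (-(Complex.I • G s x)) s := by
  rw [hasDerivAt_iff_isLittleO, Asymptotics.isLittleO_iff]
  intro c hc
  obtain ⟨C, hC0, hC⟩ := S.exists_uniform_bound hU s 1 x
  set w : H := G s x with hw
  set wn : ℕ → H := fun n => P n (G s (P n x)) with hwn
  have hwlim : Tendsto wn atTop (𝓝 w) := by
    have h1 : Tendsto (fun n => P n (G s (P n x)) - P n (G s x)) atTop (𝓝 0) := by
      refine squeeze_zero_norm (fun n => ?_)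
        (tendsto_iff_norm_sub_tendsto_zero.mp (((G s).continuous.tendsto x).comp (S.tendsto_P x)))
      rw [← map_sub]
      exact S.norm_P_le _ _
    simpa using h1.add (S.tendsto_P (G s x))
  have hcont := (continuous_limit_left hU hV s w).continuousAt (x := s)
  obtain ⟨δ, hδ, hδ'⟩ := Metric.continuousAt_iff.mp hcont (c / 8) (by positivity)
  have hη : 0 < min (min (δ / 2) 1) (c / (8 * (C + 1))) := by positivity
  filter_upwards [Metric.closedBall_mem_nhds s hη] with t ht
  rw [Metric.mem_closedBall, Real.dist_eq] at ht
  set η := min (min (δ / 2) 1) (c / (8 * (C + 1))) with hηdef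
  have hη1 : η ≤ 1 := (min_le_left _ _).trans (min_le_right _ _)
  have hηδ : η < δ := ((min_le_left _ _).trans (min_le_left _ _)).trans_lt (by linarith)
  have hηC : C * η ≤ c / 8 := by
    have h1 : η ≤ c / (8 * (C + 1)) := min_le_right _ _
    calc C * η ≤ (C + 1) * (c / (8 * (C + 1))) := by gcongr; linarith
      _ = c / 8 := by field_simp
  have key : ∀ᶠ n in atTop,
      ‖U n t s (P n (R x)) - P n (R x) - (t - s) • (-(Complex.I • wn n))‖ ≤ c * |t - s| := by
    obtain ⟨N, hN⟩ := hV s 1 w (c / 8) (by positivity)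
    have hev := Metric.tendsto_nhds.mp hwlim (c / 8) (by positivity)
    filter_upwards [hev, eventually_ge_atTop N] with n hn hnN
    rw [dist_eq_norm] at hn
    have hd : ∀ τ, HasDerivAt (fun τ => U n τ s (P n (R x)) - (τ - s) • (-(Complex.I • wn n)))
        (-(Complex.I • (P n (G τ (K n (U n τ s (P n (R x))))))) - -(Complex.I • wn n)) τ := by
      intro τ
      have h1 := (hU n).hasDerivAt_apply s τ (P n (R x))
      have h2 : HasDerivAt (fun τ : ℝ => (τ - s) • (-(Complex.I • wn n)))
          ((1 : ℝ) • (-(Complex.I • wn n))) τ :=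
        ((hasDerivAt_id τ).sub_const s).smul_const _
      rw [one_smul] at h2
      exact h1.sub h2
    have hb : ∀ τ, |τ - s| ≤ η →
        ‖-(Complex.I • (P n (G τ (K n (U n τ s (P n (R x))))))) - -(Complex.I • wn n)‖ ≤ c := by
      intro τ hτ
      have e1 : -(Complex.I • (P n (G τ (K n (U n τ s (P n (R x))))))) - -(Complex.I • wn n) =
        -(Complex.I • ((P n (G τ (K n (U n τ s (P n (R x))))) - U n τ s (wn n)) +
          (U n τ s (wn n) - U n τ s w) + (U n τ s w - V τ s w) + (V τ s w - w) + (w - wn n))) := by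
        rw [← sub_eq_zero]
        simp only [smul_add, smul_sub]
        abel
      rw [e1, norm_neg, norm_smul, Complex.norm_I, one_mul]
      have b1 := (hC n τ (hτ.trans hη1)).2
      have b2 : ‖U n τ s (wn n) - U n τ s w‖ = ‖wn n - w‖ := norm_map_sub hU n τ s _ _
      have b3 := hN n hnN τ (hτ.trans hη1)
      have b4 := hδ' (x := τ) (by rw [Real.dist_eq]; exact hτ.trans_lt hηδ)
      rw [dist_eq_norm, hV0] at b4
      have b5 : ‖w - wn n‖ = ‖wn n - w‖ := norm_sub_rev _ _
      have b6 : C * |τ - s| ≤ C * η := by gcongr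
      refine (norm_add_le _ _).trans ?_
      refine (add_le_add (norm_add_le _ _) le_rfl).trans ?_
      refine (add_le_add (add_le_add (norm_add_le _ _) le_rfl) le_rfl).trans ?_
      refine (add_le_add (add_le_add (add_le_add (norm_add_le _ _) le_rfl) le_rfl) le_rfl).trans ?_
      linarith
    have h1 := norm_sub_le_of_abs_sub_le (fun τ _ => hd τ) hb ht
    rw [sub_right_comm]
    simpa [(hU n).refl] using h1
  have hlim : Tendsto (fun n => ‖U n t s (P n (R x)) - P n (R x) -
      (t - s) • (-(Complex.I • wn n))‖) atTop
      (𝓝 ‖V t s (R x) - R x - (t - s) • (-(Complex.I • w))‖) :=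
    (((S.tendsto_apply_P hU hV t s (R x)).sub (S.tendsto_P (R x))).sub
      ((hwlim.const_smul Complex.I).neg.const_smul (t - s))).norm
  rw [hV0, Real.norm_eq_abs]
  exact le_of_tendsto hlim key

end Limit

/-- The evolution equation `i u' = 𝓗(t) u` with `𝓗(t) R = G t` is solved by a unitary propagator
that preserves the range of `R`. -/
theorem exists_propagator [CompleteSpace H] (S : GalerkinScheme R P K G) :
    ∃ V : ℝ → ℝ → H ≃ₗᵢ[ℂ] H, (∀ s ψ, V s s ψ = ψ) ∧
      (∀ t s u ψ, V t s (V s u ψ) = V t u ψ) ∧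
      (∀ ψ, Continuous fun p : ℝ × ℝ => V p.1 p.2 ψ) ∧
      ∀ x s t, ∃ y, V t s (R x) = R y ∧
        HasDerivAt (fun τ => V τ s (R x)) (-(Complex.I • G t y)) t := by
  choose U hU using fun n =>
    exists_isBoundedPropagator (S.continuous_generator n) (S.symm_generator n)
  obtain ⟨V, hV0, hVc, hV⟩ := S.exists_limit hU
  refine ⟨V, hV0, hVc, fun ψ => ?_, fun x s t => ?_⟩
  · rw [continuous_iff_continuousAt]
    rintro ⟨t₀, s₀⟩
    have h1 : Tendsto (fun p : ℝ × ℝ => V p.1 p.2 ψ - V p.1 s₀ ψ) (𝓝 (t₀, s₀)) (𝓝 0) := by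
      rw [tendsto_zero_iff_norm_tendsto_zero]
      have h2 : ∀ p : ℝ × ℝ, ‖V p.1 p.2 ψ - V p.1 s₀ ψ‖ = ‖ψ - V p.2 s₀ ψ‖ := by
        intro p
        rw [← (V p.2 p.1).norm_map, map_sub, hVc, hVc, hV0]
      simp only [h2]
      have h3 : Continuous fun p : ℝ × ℝ => ‖ψ - V p.2 s₀ ψ‖ :=
        (continuous_const.sub ((continuous_limit_left hU hV s₀ ψ).comp continuous_snd)).norm
      have h4 := h3.tendsto (t₀, s₀)
      simpa [hV0] using h4
    have h5 : Tendsto (fun p : ℝ × ℝ => V p.1 s₀ ψ) (𝓝 (t₀, s₀)) (𝓝 (V t₀ s₀ ψ)) :=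
      ((continuous_limit_left hU hV s₀ ψ).comp continuous_fst).tendsto (t₀, s₀)
    simpa [ContinuousAt] using h1.add h5
  · obtain ⟨y, hy⟩ := S.limit_mem_range hU hV t s x
    refine ⟨y, hy.symm, ?_⟩
    have h1 := S.hasDerivAt_limit_self hU hV0 hV t y
    rw [hy] at h1
    simpa only [hVc] using h1

end GalerkinScheme

end Galerkin

end DiracEvolution

end

noncomputable section

open Filter Topology
open scoped NNReal FourierTransform

namespace DiracEvolution

section FourierMultiplier

/-- Multiplication by an essentially bounded function, on `L²(ℝ³, ℂ⁴)`. -/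
def mulOp (m : Space → ℂ) (hm : MemLp m ∞ (volume : Measure Space)) : SpinorL2 →L[ℂ] SpinorL2 :=
  (ContinuousLinearMap.lsmul ℂ ℂ : ℂ →L[ℂ] Spinor →L[ℂ] Spinor).holderL volume ∞ 2 2 (hm.toLp m)

theorem mulOp_eq_smul (m : Space → ℂ) (hm : MemLp m ∞ (volume : Measure Space)) (f : SpinorL2) :
    mulOp m hm f = (hm.toLp m • f : SpinorL2) := rfl

theorem coeFn_mulOp (m : Space → ℂ) (hm : MemLp m ∞ (volume : Measure Space)) (f : SpinorL2) :
    mulOp m hm f =ᵐ[volume] fun ξ => m ξ • f ξ := by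
  rw [mulOp_eq_smul]
  filter_upwards [Lp.coeFn_lpSMul (r := 2) (hm.toLp m) f, hm.coeFn_toLp] with ξ h1 h2
  rw [h1, Pi.smul_apply', h2]

/-- The Fourier multiplier with an essentially bounded symbol, on `L²(ℝ³, ℂ⁴)`. -/
def fourierMul (m : Space → ℂ) (hm : MemLp m ∞ (volume : Measure Space)) :
    SpinorL2 →L[ℂ] SpinorL2 :=
  (Lp.fourierTransformₗᵢ Space Spinor).symm.toContinuousLinearEquiv.toContinuousLinearMap ∘L
    mulOp m hm ∘L (Lp.fourierTransformₗᵢ Space Spinor).toContinuousLinearEquiv.toContinuousLinearMap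

variable {m m₁ m₂ : Space → ℂ} {hm : MemLp m ∞ (volume : Measure Space)}
  {hm₁ : MemLp m₁ ∞ (volume : Measure Space)} {hm₂ : MemLp m₂ ∞ (volume : Measure Space)}

theorem fourier_fourierMul (f : SpinorL2) : 𝓕 (fourierMul m hm f) = mulOp m hm (𝓕 f) :=
  (Lp.fourierTransformₗᵢ Space Spinor).apply_symm_apply _

theorem fourier_injective {f g : SpinorL2} (h : 𝓕 f = 𝓕 g) : f = g :=
  (Lp.fourierTransformₗᵢ Space Spinor).injective h

theorem coeFn_fourier_fourierMul (f : SpinorL2) :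
    (𝓕 (fourierMul m hm f) : SpinorL2) =ᵐ[volume] fun ξ => m ξ • (𝓕 f : SpinorL2) ξ := by
  rw [fourier_fourierMul]
  exact coeFn_mulOp m hm _

theorem fourierMul_fourierMul (h : ∀ ξ, m₁ ξ * m₂ ξ = m ξ) (f : SpinorL2) :
    fourierMul m₁ hm₁ (fourierMul m₂ hm₂ f) = fourierMul m hm f := by
  apply fourier_injective
  apply Lp.ext
  filter_upwards [coeFn_fourier_fourierMul (hm := hm₁) (fourierMul m₂ hm₂ f),
    coeFn_fourier_fourierMul (hm := hm₂) f, coeFn_fourier_fourierMul (hm := hm) f] with ξ h1 h2 h3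
  rw [h1, h2, h3, smul_smul, h]

theorem fourierMul_comm (f : SpinorL2) :
    fourierMul m₁ hm₁ (fourierMul m₂ hm₂ f) = fourierMul m₂ hm₂ (fourierMul m₁ hm₁ f) := by
  apply fourier_injective
  apply Lp.ext
  filter_upwards [coeFn_fourier_fourierMul (hm := hm₁) (fourierMul m₂ hm₂ f),
    coeFn_fourier_fourierMul (hm := hm₂) f, coeFn_fourier_fourierMul (hm := hm₁) f,
    coeFn_fourier_fourierMul (hm := hm₂) (fourierMul m₁ hm₁ f)] with ξ h1 h2 h3 h4
  rw [h1, h2, h4, h3, smul_comm]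

theorem inner_fourierMul_left (h : ∀ ξ, m₁ ξ = starRingEnd ℂ (m ξ)) (f g : SpinorL2) :
    inner ℂ (fourierMul m hm f) g = inner ℂ f (fourierMul m₁ hm₁ g) := by
  rw [← Lp.inner_fourier_eq, ← Lp.inner_fourier_eq f, L2.inner_def, L2.inner_def]
  apply integral_congr_ae
  filter_upwards [coeFn_fourier_fourierMul (hm := hm) f,
    coeFn_fourier_fourierMul (hm := hm₁) g] with ξ h1 h2
  rw [h1, h2, inner_smul_left, inner_smul_right, h]

theorem norm_fourierMul_le {C : ℝ} (h : ∀ ξ, ‖m ξ‖ ≤ C) (f : SpinorL2) :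
    ‖fourierMul m hm f‖ ≤ C * ‖f‖ := by
  rw [← Lp.norm_fourier_eq, ← Lp.norm_fourier_eq f]
  apply Lp.norm_le_mul_norm_of_ae_le_mul
  filter_upwards [coeFn_fourier_fourierMul (hm := hm) f] with ξ h1
  rw [h1, norm_smul]
  gcongr
  exact h ξ

theorem toTemperedDistribution_fourierMul (hg : m.HasTemperateGrowth) (f : SpinorL2) :
    (fourierMul m hm f : 𝓢'(Space, Spinor)) =
      TemperedDistribution.fourierMultiplierCLM Spinor m (f : 𝓢'(Space, Spinor)) := by
  rw [TemperedDistribution.fourierMultiplierCLM_apply, Lp.fourier_toTemperedDistribution_eq,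
    ← Lp.toTemperedDistribution_smul_eq (p := ∞) (r := 2) hg hm,
    Lp.fourierInv_toTemperedDistribution_eq]
  rfl

theorem toTemperedDistribution_matrixAct (M : Matrix (Fin 4) (Fin 4) ℂ) (f : SpinorL2)
    (g : 𝓢(Space, ℂ)) :
    (matrixAct M f : 𝓢'(Space, Spinor)) g =
      Matrix.toEuclideanCLM (n := Fin 4) (𝕜 := ℂ) M ((f : 𝓢'(Space, Spinor)) g) := by
  rw [Lp.toTemperedDistribution_apply, Lp.toTemperedDistribution_apply,
    ← ContinuousLinearMap.integral_comp_comm]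
  · apply integral_congr_ae
    filter_upwards [ContinuousLinearMap.coeFn_compLpL (p := 2) (μ := (volume : Measure Space))
      (Matrix.toEuclideanCLM (n := Fin 4) (𝕜 := ℂ) M) f] with x hx
    rw [map_smul]
    exact congrArg _ hx
  · exact memLp_one_iff_integrable.mp ((Lp.memLp f).smul (g.memLp 2))

theorem coeFn_matrixAct (M : Matrix (Fin 4) (Fin 4) ℂ) (f : SpinorL2) :
    matrixAct M f =ᵐ[volume] fun x => Matrix.toEuclideanCLM (n := Fin 4) (𝕜 := ℂ) M (f x) :=
  ContinuousLinearMap.coeFn_compLpL (p := 2) (μ := (volume : Measure Space))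
      (Matrix.toEuclideanCLM (n := Fin 4) (𝕜 := ℂ) M) f

theorem fourier_matrixAct (M : Matrix (Fin 4) (Fin 4) ℂ) (f : SpinorL2) :
    𝓕 (matrixAct M f) = matrixAct M (𝓕 f) := by
  apply toTemperedDistribution_injective
  ext1 g
  rw [toTemperedDistribution_matrixAct, ← Lp.fourier_toTemperedDistribution_eq,
    ← Lp.fourier_toTemperedDistribution_eq, TemperedDistribution.fourier_apply,
    TemperedDistribution.fourier_apply, toTemperedDistribution_matrixAct]

theorem matrixAct_fourierMul (M : Matrix (Fin 4) (Fin 4) ℂ) (f : SpinorL2) :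
    matrixAct M (fourierMul m hm f) = fourierMul m hm (matrixAct M f) := by
  apply fourier_injective
  rw [fourier_matrixAct]
  apply Lp.ext
  filter_upwards [coeFn_matrixAct M (𝓕 (fourierMul m hm f)), coeFn_fourier_fourierMul (hm := hm) f,
    coeFn_fourier_fourierMul (hm := hm) (matrixAct M f), coeFn_matrixAct M (𝓕 f)] with ξ h1 h2 h3 h4
  rw [h1, h2, h3, fourier_matrixAct, h4, map_smul]

theorem inner_matrixAct_left {M : Matrix (Fin 4) (Fin 4) ℂ} (hM : M.conjTranspose = M)
    (f g : SpinorL2) : inner ℂ (matrixAct M f) g = inner ℂ f (matrixAct M g) := by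
  rw [L2.inner_def, L2.inner_def]
  apply integral_congr_ae
  filter_upwards [coeFn_matrixAct M f, coeFn_matrixAct M g] with x h1 h2
  have h3 : ContinuousLinearMap.adjoint (Matrix.toEuclideanCLM (n := Fin 4) (𝕜 := ℂ) M) =
      Matrix.toEuclideanCLM (n := Fin 4) (𝕜 := ℂ) M := by
    rw [← ContinuousLinearMap.star_eq_adjoint, ← map_star, Matrix.star_eq_conjTranspose, hM]
  rw [h1, h2, ← ContinuousLinearMap.adjoint_inner_right, h3]

end FourierMultiplier

theorem pauli_conjTranspose (k : Fin 3) : (pauli k).conjTranspose = pauli k := by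
  ext i j
  fin_cases k <;> fin_cases i <;> fin_cases j <;> simp [pauli]

theorem diracAlpha_conjTranspose (k : Fin 3) : (diracAlpha k).conjTranspose = diracAlpha k := by
  rw [diracAlpha, ofBlocks, Matrix.conjTranspose_reindex, Matrix.fromBlocks_conjTranspose,
    pauli_conjTranspose, Matrix.conjTranspose_zero]

theorem diracBeta_conjTranspose : diracBeta.conjTranspose = diracBeta := by
  rw [diracBeta, ofBlocks, Matrix.conjTranspose_reindex, Matrix.fromBlocks_conjTranspose]
  simp

/-- The symbol `α·a + β` of the free Dirac operator. -/
def diracSymbol (a : Fin 3 → ℝ) : Matrix (Fin 4) (Fin 4) ℂ :=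
  (∑ k, (a k : ℂ) • diracAlpha k) + diracBeta

theorem diracSymbol_conjTranspose (a : Fin 3 → ℝ) :
    (diracSymbol a).conjTranspose = diracSymbol a := by
  simp [diracSymbol, Matrix.conjTranspose_sum, diracAlpha_conjTranspose, diracBeta_conjTranspose]

theorem sum_smul_pauli_mul_self (a : Fin 3 → ℝ) :
    (∑ k, (a k : ℂ) • pauli k) * (∑ k, (a k : ℂ) • pauli k) = ((∑ k, a k ^ 2 : ℝ) : ℂ) • 1 := by
  ext i j
  fin_cases i <;> fin_cases j <;>
    simp [pauli, Fin.sum_univ_three, Matrix.mul_apply, Fin.sum_univ_two] <;> ring_nf <;>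
    simp [Complex.I_sq]

theorem diracSymbol_eq (a : Fin 3 → ℝ) :
    diracSymbol a = ofBlocks 1 (∑ k, (a k : ℂ) • pauli k) (∑ k, (a k : ℂ) • pauli k) (-1) := by
  simp only [diracSymbol, diracAlpha, diracBeta, ofBlocks, Matrix.reindex_apply]
  ext i j
  simp only [Fin.sum_univ_three, Matrix.add_apply, Matrix.smul_apply, Matrix.submatrix_apply]
  rcases (finSumFinEquiv : Fin 2 ⊕ Fin 2 ≃ Fin 4).symm i with i | i <;>
    rcases (finSumFinEquiv : Fin 2 ⊕ Fin 2 ≃ Fin 4).symm j with j | j <;> simp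

theorem diracSymbol_mul_self (a : Fin 3 → ℝ) :
    diracSymbol a * diracSymbol a = ((∑ k, a k ^ 2 + 1 : ℝ) : ℂ) • 1 := by
  rw [diracSymbol_eq]
  simp only [ofBlocks, Matrix.reindex_apply]
  rw [Matrix.submatrix_mul_equiv, Matrix.fromBlocks_multiply, sum_smul_pauli_mul_self]
  simp only [one_mul, mul_one, mul_neg, neg_mul, neg_neg, add_neg_cancel, Complex.ofReal_add,
    Complex.ofReal_one]
  have h : (1 : Matrix (Fin 4) (Fin 4) ℂ) =
      (Matrix.fromBlocks 1 0 0 1 : Matrix (Fin 2 ⊕ Fin 2) (Fin 2 ⊕ Fin 2) ℂ).submatrix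
        finSumFinEquiv.symm finSumFinEquiv.symm := by
    rw [Matrix.fromBlocks_one, Matrix.submatrix_one_equiv]
  rw [h]
  change _ = (((((∑ k, a k ^ 2 : ℝ) : ℂ) + 1) • Matrix.fromBlocks 1 0 0 1).submatrix _ _)
  rw [Matrix.fromBlocks_smul, smul_zero, add_smul, one_smul,
    add_comm (1 : Matrix (Fin 2) (Fin 2) ℂ)]

theorem norm_sq_diracSymbol_apply (a : Fin 3 → ℝ) (v : Spinor) :
    ‖Matrix.toEuclideanCLM (n := Fin 4) (𝕜 := ℂ) (diracSymbol a) v‖ ^ 2 =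
      (∑ k, a k ^ 2 + 1) * ‖v‖ ^ 2 := by
  have h3 : ContinuousLinearMap.adjoint
      (Matrix.toEuclideanCLM (n := Fin 4) (𝕜 := ℂ) (diracSymbol a)) =
      Matrix.toEuclideanCLM (n := Fin 4) (𝕜 := ℂ) (diracSymbol a) := by
    rw [← ContinuousLinearMap.star_eq_adjoint, ← map_star, Matrix.star_eq_conjTranspose,
      diracSymbol_conjTranspose]
  have h4 : Matrix.toEuclideanCLM (n := Fin 4) (𝕜 := ℂ) (diracSymbol a)
      (Matrix.toEuclideanCLM (n := Fin 4) (𝕜 := ℂ) (diracSymbol a) v) =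
      ((∑ k, a k ^ 2 + 1 : ℝ) : ℂ) • v := by
    rw [← mul_apply_eq_comp, ← map_mul, diracSymbol_mul_self, map_smul, map_one]
    rfl
  have h5 : inner ℂ (Matrix.toEuclideanCLM (n := Fin 4) (𝕜 := ℂ) (diracSymbol a) v)
      (Matrix.toEuclideanCLM (n := Fin 4) (𝕜 := ℂ) (diracSymbol a) v) =
      ((∑ k, a k ^ 2 + 1 : ℝ) : ℂ) * inner ℂ v v := by
    rw [← ContinuousLinearMap.adjoint_inner_right, h3, h4, inner_smul_right]
  rw [@norm_sq_eq_re_inner ℂ, h5, @norm_sq_eq_re_inner ℂ, RCLike.re_eq_complex_re,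
    Complex.re_ofReal_mul]

/-- The symbol `(1 + |ξ|²)^(-1/2)`. -/
def resolventSymbol (ξ : Space) : ℂ := (((1 + ‖ξ‖ ^ 2) ^ ((-1 : ℝ) / 2) : ℝ) : ℂ)

/-- The symbol of `∂ₖ (1 - Δ/4π²)^(-1/2)`. -/
def derivSymbol (k : Fin 3) (ξ : Space) : ℂ :=
  (2 * Real.pi * Complex.I) * ((inner ℝ ξ (EuclideanSpace.single k (1 : ℝ) : Space) : ℝ) : ℂ) *
    resolventSymbol ξ

/-- The indicator function of `|ξ| ≤ n`. -/
def cutoffSymbol (n : ℕ) (ξ : Space) : ℂ := if ‖ξ‖ ≤ n then 1 else 0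

/-- The function `(1 + |ξ|²)^(1/2)`, cut off to `|ξ| ≤ n`. -/
def cutoffInvSymbol (n : ℕ) (ξ : Space) : ℂ := if ‖ξ‖ ≤ n then (resolventSymbol ξ)⁻¹ else 0

theorem hasTemperateGrowth_resolventSymbol : resolventSymbol.HasTemperateGrowth := by
  unfold resolventSymbol
  fun_prop

theorem hasTemperateGrowth_derivSymbol (k : Fin 3) : (derivSymbol k).HasTemperateGrowth := by
  have h : (fun ξ : Space => ((inner ℝ ξ (EuclideanSpace.single k (1 : ℝ) : Space) : ℝ) : ℂ) *
    resolventSymbol ξ).HasTemperateGrowth := by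
    unfold resolventSymbol
    fun_prop
  have h2 := (Function.HasTemperateGrowth.const (E := Space) (2 * Real.pi * Complex.I : ℂ)).mul h
  convert! h2 using 1
  funext ξ
  simp [derivSymbol, mul_assoc]

theorem norm_resolventSymbol (ξ : Space) :
    ‖resolventSymbol ξ‖ = (1 + ‖ξ‖ ^ 2) ^ ((-1 : ℝ) / 2) := by
  rw [resolventSymbol, Complex.norm_real, Real.norm_eq_abs, abs_of_nonneg (by positivity)]

theorem norm_resolventSymbol_sq (ξ : Space) : ‖resolventSymbol ξ‖ ^ 2 = (1 + ‖ξ‖ ^ 2)⁻¹ := by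
  rw [norm_resolventSymbol, ← Real.rpow_natCast, ← Real.rpow_mul (by positivity),
    ← Real.rpow_neg_one]
  norm_num

theorem resolventSymbol_ne_zero (ξ : Space) : resolventSymbol ξ ≠ 0 := by
  rw [← norm_ne_zero_iff, norm_resolventSymbol]
  positivity

theorem norm_resolventSymbol_le_of_le {ξ : Space} {c : ℝ} (hc : 0 ≤ c) (h : c ≤ ‖ξ‖) :
    ‖resolventSymbol ξ‖ ≤ (1 + c ^ 2) ^ ((-1 : ℝ) / 2) := by
  rw [norm_resolventSymbol]
  exact Real.rpow_le_rpow_of_nonpos (by positivity) (by gcongr) (by norm_num)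

theorem norm_resolventSymbol_le_one (ξ : Space) : ‖resolventSymbol ξ‖ ≤ 1 := by
  simpa using norm_resolventSymbol_le_of_le le_rfl (norm_nonneg ξ)

theorem norm_derivSymbol_le (k : Fin 3) (ξ : Space) : ‖derivSymbol k ξ‖ ≤ 2 * Real.pi := by
  have h1 : |inner ℝ ξ (EuclideanSpace.single k (1 : ℝ) : Space)| ≤ ‖ξ‖ := by
    simpa using abs_real_inner_le_norm ξ (EuclideanSpace.single k (1 : ℝ) : Space)
  have h2 : ‖ξ‖ * ‖resolventSymbol ξ‖ ≤ 1 := by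
    refine le_of_sq_le_sq ?_ zero_le_one
    rw [mul_pow, norm_resolventSymbol_sq, one_pow, ← div_eq_mul_inv, div_le_one (by positivity)]
    linarith
  rw [derivSymbol, norm_mul, norm_mul, norm_mul, norm_mul, Complex.norm_I, Complex.norm_real,
    Complex.norm_real, Complex.norm_ofNat, Real.norm_of_nonneg Real.pi_nonneg, Real.norm_eq_abs,
    mul_one, mul_assoc]
  refine mul_le_of_le_one_right (by positivity) (le_trans ?_ h2)
  gcongr

theorem memLp_resolventSymbol : MemLp resolventSymbol ∞ (volume : Measure Space) :=
  memLp_top_of_bound hasTemperateGrowth_resolventSymbol.1.continuous.aestronglyMeasurable 1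
    (.of_forall norm_resolventSymbol_le_one)

theorem memLp_derivSymbol (k : Fin 3) : MemLp (derivSymbol k) ∞ (volume : Measure Space) :=
  memLp_top_of_bound (hasTemperateGrowth_derivSymbol k).1.continuous.aestronglyMeasurable
    (2 * Real.pi) (.of_forall (norm_derivSymbol_le k))

theorem measurableSet_norm_le (n : ℕ) : MeasurableSet {ξ : Space | ‖ξ‖ ≤ n} :=
  measurableSet_le measurable_norm measurable_const

theorem memLp_cutoffSymbol (n : ℕ) : MemLp (cutoffSymbol n) ∞ (volume : Measure Space) := by
  refine memLp_top_of_bound ?_ 1 (.of_forall fun ξ => ?_)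
  · exact (Measurable.ite (measurableSet_norm_le n) measurable_const
      measurable_const).aestronglyMeasurable
  · unfold cutoffSymbol
    split_ifs <;> simp

theorem memLp_cutoffInvSymbol (n : ℕ) : MemLp (cutoffInvSymbol n) ∞ (volume : Measure Space) := by
  refine memLp_top_of_bound ?_ (1 + n ^ 2) (.of_forall fun ξ => ?_)
  · exact (Measurable.ite (measurableSet_norm_le n)
      hasTemperateGrowth_resolventSymbol.1.continuous.measurable.inv
      measurable_const).aestronglyMeasurable
  · unfold cutoffInvSymbol
    split_ifs with h
    · have h0 := norm_pos_iff.mpr (resolventSymbol_ne_zero ξ)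
      have h1 : ‖resolventSymbol ξ‖⁻¹ * ‖resolventSymbol ξ‖ ^ 2 ≤ 1 := by
        rw [sq, inv_mul_cancel_left₀ h0.ne']
        exact norm_resolventSymbol_le_one ξ
      rw [norm_resolventSymbol_sq, ← div_eq_mul_inv, div_le_one (by positivity)] at h1
      rw [norm_inv]
      refine h1.trans ?_
      gcongr
    · simp only [norm_zero]
      positivity

/-- The operator `(1 - Δ/4π²)^(-1/2)` on `L²(ℝ³, ℂ⁴)`. -/
def besselOp : SpinorL2 →L[ℂ] SpinorL2 := fourierMul resolventSymbol memLp_resolventSymbol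

/-- The operator `∂ₖ (1 - Δ/4π²)^(-1/2)` on `L²(ℝ³, ℂ⁴)`. -/
def derivBesselOp (k : Fin 3) : SpinorL2 →L[ℂ] SpinorL2 :=
  fourierMul (derivSymbol k) (memLp_derivSymbol k)

/-- The projection to frequencies `|ξ| ≤ n`. -/
def cutoffOp (n : ℕ) : SpinorL2 →L[ℂ] SpinorL2 := fourierMul (cutoffSymbol n) (memLp_cutoffSymbol n)

/-- The inverse of `besselOp` on the frequencies `|ξ| ≤ n`. -/
def cutoffInvOp (n : ℕ) : SpinorL2 →L[ℂ] SpinorL2 :=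
  fourierMul (cutoffInvSymbol n) (memLp_cutoffInvSymbol n)

theorem toTemperedDistribution_besselOp (x : SpinorL2) :
    (besselOp x : 𝓢'(Space, Spinor)) =
      TemperedDistribution.besselPotential Space Spinor (-1) (x : 𝓢'(Space, Spinor)) :=
  toTemperedDistribution_fourierMul hasTemperateGrowth_resolventSymbol x

theorem mem_sobolevH1_iff (ψ : SpinorL2) : ψ ∈ sobolevH1 ↔ ∃ x, besselOp x = ψ := by
  change (∃ x : SpinorL2, TemperedDistribution.besselPotential Space Spinor 1
    (ψ : 𝓢'(Space, Spinor)) = x) ↔ _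
  refine exists_congr fun x => ?_
  rw [← TemperedDistribution.besselPotential_neg_apply_eq_iff, ← toTemperedDistribution_besselOp]
  exact ⟨toTemperedDistribution_injective, fun h => congrArg _ h⟩

theorem besselOp_mem_sobolevH1 (x : SpinorL2) : besselOp x ∈ sobolevH1 :=
  (mem_sobolevH1_iff _).mpr ⟨x, rfl⟩

theorem toTemperedDistribution_derivBesselOp (k : Fin 3) (x : SpinorL2) :
    (derivBesselOp k x : 𝓢'(Space, Spinor)) =
      ∂_{(EuclideanSpace.single k (1 : ℝ) : Space)} (besselOp x : 𝓢'(Space, Spinor)) := by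
  rw [derivBesselOp, toTemperedDistribution_fourierMul (hasTemperateGrowth_derivSymbol k),
    TemperedDistribution.lineDeriv_eq_fourierMultiplierCLM, besselOp,
    toTemperedDistribution_fourierMul hasTemperateGrowth_resolventSymbol,
    TemperedDistribution.fourierMultiplierCLM_fourierMultiplierCLM_apply
      hasTemperateGrowth_resolventSymbol (by fun_prop)]
  have hg : (resolventSymbol * fun ξ : Space =>
      ((inner ℝ ξ (EuclideanSpace.single k (1 : ℝ) : Space) : ℝ) : ℂ)).HasTemperateGrowth :=
    hasTemperateGrowth_resolventSymbol.mul (by fun_prop)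
  have h := TemperedDistribution.fourierMultiplierCLM_smul (F := Spinor) hg
    (2 * Real.pi * Complex.I)
  rw [← smul_apply, ← h]
  congr 2
  funext ξ
  simp only [derivSymbol, Pi.smul_apply, Pi.mul_apply, smul_eq_mul]
  ring

theorem partialDeriv_besselOp (k : Fin 3) (x : SpinorL2) :
    partialDeriv k ⟨besselOp x, besselOp_mem_sobolevH1 x⟩ = derivBesselOp k x := by
  apply toTemperedDistribution_injective
  rw [partialDeriv_spec, toTemperedDistribution_derivBesselOp]

/-- The bounded operator `H₀ (1 - Δ/4π²)^(-1/2)`, where `H₀` is the free Dirac operator. -/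
def freeDiracBessel (ε : ℝ) : SpinorL2 →L[ℂ] SpinorL2 :=
  (-Complex.I * (ε : ℂ)) • (∑ k, matrixAct (diracAlpha k) ∘L derivBesselOp k) +
    matrixAct diracBeta ∘L besselOp

theorem freeDiracBessel_apply (ε : ℝ) (x : SpinorL2) : freeDiracBessel ε x =
    (-Complex.I * (ε : ℂ)) • (∑ k, matrixAct (diracAlpha k) (derivBesselOp k x)) +
      matrixAct diracBeta (besselOp x) := by
  simp [freeDiracBessel, _root_.sum_apply]

theorem freeDirac_besselOp (ε : ℝ) (x : SpinorL2) :
    freeDirac ε ⟨besselOp x, besselOp_mem_sobolevH1 x⟩ = freeDiracBessel ε x := by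
  simp [freeDirac, freeDiracBessel_apply, partialDeriv_besselOp, LinearMap.sum_apply]

theorem freeDiracBessel_fourierMul {m : Space → ℂ} {hm : MemLp m ∞ (volume : Measure Space)}
    (ε : ℝ) (x : SpinorL2) :
    freeDiracBessel ε (fourierMul m hm x) = fourierMul m hm (freeDiracBessel ε x) := by
  rw [freeDiracBessel_apply, freeDiracBessel_apply, map_add, map_smul, map_sum]
  simp only [derivBesselOp, besselOp, ← matrixAct_fourierMul]
  simp only [fourierMul_comm (hm₂ := hm)]

theorem inner_besselOp_left (x y : SpinorL2) :
    inner ℂ (besselOp x) y = inner ℂ x (besselOp y) :=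
  inner_fourierMul_left (fun ξ => by rw [resolventSymbol, Complex.conj_ofReal]) x y

theorem inner_derivBesselOp_left (k : Fin 3) (x y : SpinorL2) :
    inner ℂ (derivBesselOp k x) y = -inner ℂ x (derivBesselOp k y) := by
  have hm : MemLp (fun ξ => -derivSymbol k ξ) ∞ (volume : Measure Space) := (memLp_derivSymbol k).neg
  have h : fourierMul _ hm y = -derivBesselOp k y := by
    apply fourier_injective
    rw [FourierTransform.fourier_neg]
    apply Lp.ext
    filter_upwards [coeFn_fourier_fourierMul (hm := hm) y, Lp.coeFn_neg (𝓕 (derivBesselOp k y)),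
      coeFn_fourier_fourierMul (hm := memLp_derivSymbol k) y] with ξ h1 h2 h3
    rw [h1, h2, Pi.neg_apply, derivBesselOp, h3, neg_smul]
  rw [← inner_neg_right, ← h]
  refine inner_fourierMul_left (fun ξ => ?_) x y
  simp [derivSymbol, resolventSymbol, (map_ofNat (starRingEnd ℂ) 2 : starRingEnd ℂ 2 = 2)]

theorem inner_freeDiracBessel_left (ε : ℝ) (x y : SpinorL2) :
    inner ℂ (freeDiracBessel ε x) y = inner ℂ x (freeDiracBessel ε y) := by
  rw [freeDiracBessel_apply, freeDiracBessel_apply, inner_add_left, inner_add_right,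
    inner_smul_left, inner_smul_right, sum_inner, inner_sum, inner_matrixAct_left
      diracBeta_conjTranspose, inner_besselOp_left]
  congr 1
  · rw [Finset.mul_sum, Finset.mul_sum]
    refine Finset.sum_congr rfl fun k _ => ?_
    rw [inner_matrixAct_left (diracAlpha_conjTranspose k), inner_derivBesselOp_left, derivBesselOp,
      matrixAct_fourierMul]
    simp
  · rw [besselOp, matrixAct_fourierMul]

/-- The lower bound of the free Dirac operator. -/
def freeDiracConst (ε : ℝ) : ℝ := min 1 (2 * Real.pi * ε)

theorem freeDiracConst_pos {ε : ℝ} (hε : 0 < ε) : 0 < freeDiracConst ε :=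
  lt_min one_pos (by positivity)

theorem coeFn_fourier_freeDiracBessel (ε : ℝ) (x : SpinorL2) :
    (𝓕 (freeDiracBessel ε x) : SpinorL2) =ᵐ[volume] fun ξ =>
      resolventSymbol ξ • Matrix.toEuclideanCLM (n := Fin 4) (𝕜 := ℂ)
        (diracSymbol fun k => 2 * Real.pi * ε * ξ k) ((𝓕 x : SpinorL2) ξ) := by
  have h : 𝓕 (freeDiracBessel ε x) = (-Complex.I * (ε : ℂ)) •
      (∑ k, matrixAct (diracAlpha k) (𝓕 (derivBesselOp k x))) +
      matrixAct diracBeta (𝓕 (besselOp x)) := by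
    simp only [← fourier_matrixAct]
    rw [freeDiracBessel_apply]
    exact ((Lp.fourierTransformₗᵢ Space Spinor).map_add _ _).trans (congrArg₂ _
      (((Lp.fourierTransformₗᵢ Space Spinor).map_smul _ _).trans
        (congrArg _ (map_sum (Lp.fourierTransformₗᵢ Space Spinor) _ _))) rfl)
  rw [h, Fin.sum_univ_three]
  have hd := fun k => coeFn_fourier_fourierMul (hm := memLp_derivSymbol k) x
  have hα := fun k => coeFn_matrixAct (diracAlpha k) (𝓕 (derivBesselOp k x))
  filter_upwards [Lp.coeFn_add ((-Complex.I * (ε : ℂ)) •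
      (matrixAct (diracAlpha 0) (𝓕 (derivBesselOp 0 x)) +
        matrixAct (diracAlpha 1) (𝓕 (derivBesselOp 1 x)) +
        matrixAct (diracAlpha 2) (𝓕 (derivBesselOp 2 x)))) (matrixAct diracBeta (𝓕 (besselOp x))),
    Lp.coeFn_smul (-Complex.I * (ε : ℂ)) (matrixAct (diracAlpha 0) (𝓕 (derivBesselOp 0 x)) +
        matrixAct (diracAlpha 1) (𝓕 (derivBesselOp 1 x)) +
        matrixAct (diracAlpha 2) (𝓕 (derivBesselOp 2 x))),
    Lp.coeFn_add (matrixAct (diracAlpha 0) (𝓕 (derivBesselOp 0 x)) +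
        matrixAct (diracAlpha 1) (𝓕 (derivBesselOp 1 x)))
        (matrixAct (diracAlpha 2) (𝓕 (derivBesselOp 2 x))),
    Lp.coeFn_add (matrixAct (diracAlpha 0) (𝓕 (derivBesselOp 0 x)))
        (matrixAct (diracAlpha 1) (𝓕 (derivBesselOp 1 x))),
    hd 0, hd 1, hd 2, hα 0, hα 1, hα 2, coeFn_matrixAct diracBeta (𝓕 (besselOp x)),
    coeFn_fourier_fourierMul (hm := memLp_resolventSymbol) x]
    with ξ e1 e2 e3 e4 d0 d1 d2 a0 a1 a2 b r
  rw [e1, Pi.add_apply, e2, Pi.smul_apply, e3, Pi.add_apply, e4, Pi.add_apply, a0, a1, a2, b]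
  simp only [derivBesselOp, besselOp]
  rw [d0, d1, d2, r]
  simp only [diracSymbol, Fin.sum_univ_three, map_add, map_smul, add_apply, smul_apply, smul_add,
    smul_smul, derivSymbol]
  congr 1
  congr 1
  · congr 1
    all_goals
      congr 1
      simp only [EuclideanSpace.inner_single_right, conj_trivial, one_mul]
      push_cast
      linear_combination (-2 * Real.pi * ε * ξ _ * resolventSymbol ξ : ℂ) * Complex.I_sq
  · congr 1
    simp only [EuclideanSpace.inner_single_right, conj_trivial, one_mul]
    push_cast
    linear_combination (-2 * Real.pi * ε * ξ _ * resolventSymbol ξ : ℂ) * Complex.I_sq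

theorem norm_le_norm_freeDiracBessel {ε : ℝ} (hε : 0 < ε) (x : SpinorL2) :
    freeDiracConst ε * ‖x‖ ≤ ‖freeDiracBessel ε x‖ := by
  have hc := freeDiracConst_pos hε
  rw [← Lp.norm_fourier_eq x, ← Lp.norm_fourier_eq (freeDiracBessel ε x), mul_comm,
    ← le_div_iff₀ hc, div_eq_inv_mul]
  apply Lp.norm_le_mul_norm_of_ae_le_mul
  filter_upwards [coeFn_fourier_freeDiracBessel ε x] with ξ h
  rw [← div_eq_inv_mul, le_div_iff₀ hc, mul_comm, h, norm_smul]
  refine le_of_sq_le_sq ?_ (by positivity)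
  rw [mul_pow, mul_pow, norm_sq_diracSymbol_apply, norm_resolventSymbol_sq, ← mul_assoc]
  gcongr
  rw [← div_eq_inv_mul, le_div_iff₀ (by positivity)]
  have h1 : ∑ k, (2 * Real.pi * ε * ξ k) ^ 2 = (2 * Real.pi * ε) ^ 2 * ‖ξ‖ ^ 2 := by
    rw [EuclideanSpace.norm_sq_eq, Finset.mul_sum]
    simp [mul_pow]
  rw [h1]
  have h2 : freeDiracConst ε ^ 2 ≤ 1 ^ 2 := by gcongr; exact min_le_left _ _
  have h3 : freeDiracConst ε ^ 2 ≤ (2 * Real.pi * ε) ^ 2 := by gcongr; exact min_le_right _ _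
  nlinarith [sq_nonneg ‖ξ‖]

theorem denseRange_besselOp : DenseRange besselOp := by
  refine Dense.mono ?_ (SchwartzMap.denseRange_toLpCLM (F := Spinor) (E := Space) (p := 2)
    (μ := volume) ENNReal.ofNat_ne_top)
  rintro _ ⟨f, rfl⟩
  refine (mem_sobolevH1_iff _).mp ?_
  have h := SchwartzMap.memSobolev (s := 1) (p := 2) f
  rw [← Lp.toTemperedDistribution_toLp_eq (p := 2)] at h
  exact h

theorem cutoffOp_cutoffOp {n k : ℕ} (h : n ≤ k) (x : SpinorL2) :
    cutoffOp k (cutoffOp n x) = cutoffOp n x := by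
  refine fourierMul_fourierMul (fun ξ => ?_) x
  unfold cutoffSymbol
  have h' : (n : ℝ) ≤ k := by exact_mod_cast h
  split_ifs with h1 h2
  · simp
  · simp
  · exact absurd (le_trans ‹_› h') h1
  · simp

theorem besselOp_cutoffInvOp (n : ℕ) (x : SpinorL2) :
    besselOp (cutoffInvOp n x) = cutoffOp n x := by
  refine fourierMul_fourierMul (fun ξ => ?_) x
  unfold cutoffSymbol cutoffInvSymbol
  split_ifs
  · exact mul_inv_cancel₀ (resolventSymbol_ne_zero ξ)
  · simp

theorem cutoffInvOp_besselOp (n : ℕ) (x : SpinorL2) :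
    cutoffInvOp n (besselOp x) = cutoffOp n x := by
  rw [← besselOp_cutoffInvOp]
  exact fourierMul_comm x

theorem cutoffOp_cutoffInvOp (n : ℕ) (x : SpinorL2) :
    cutoffOp n (cutoffInvOp n x) = cutoffInvOp n x := by
  refine fourierMul_fourierMul (fun ξ => ?_) x
  unfold cutoffSymbol cutoffInvSymbol
  split_ifs <;> simp

theorem inner_cutoffOp_left (n : ℕ) (x y : SpinorL2) :
    inner ℂ (cutoffOp n x) y = inner ℂ x (cutoffOp n y) := by
  refine inner_fourierMul_left (fun ξ => ?_) x y
  unfold cutoffSymbol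
  split_ifs <;> simp

theorem norm_cutoffOp_le (n : ℕ) (x : SpinorL2) : ‖cutoffOp n x‖ ≤ ‖x‖ := by
  have h := norm_fourierMul_le (hm := memLp_cutoffSymbol n) (C := 1) (fun ξ => by
    unfold cutoffSymbol
    split_ifs <;> simp) x
  rwa [one_mul] at h

theorem norm_one_sub_cutoffOp_mul_besselOp_le (n : ℕ) :
    ‖(1 - cutoffOp n) * besselOp‖ ≤ (1 + (n : ℝ) ^ 2) ^ ((-1 : ℝ) / 2) := by
  refine ContinuousLinearMap.opNorm_le_bound _ (by positivity) fun x => ?_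
  rw [← Lp.norm_fourier_eq, ← Lp.norm_fourier_eq x]
  apply Lp.norm_le_mul_norm_of_ae_le_mul
  have h : 𝓕 (((1 - cutoffOp n) * besselOp) x) =
      𝓕 (besselOp x) - 𝓕 (cutoffOp n (besselOp x)) :=
    (Lp.fourierTransformₗᵢ Space Spinor).map_sub _ _
  rw [h]
  filter_upwards [Lp.coeFn_sub (𝓕 (besselOp x)) (𝓕 (cutoffOp n (besselOp x))),
    coeFn_fourier_fourierMul (hm := memLp_resolventSymbol) x,
    coeFn_fourier_fourierMul (hm := memLp_cutoffSymbol n) (besselOp x)] with ξ h1 h2 h3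
  rw [h1, Pi.sub_apply, cutoffOp, h3, besselOp, h2]
  unfold cutoffSymbol
  split_ifs with h4
  · rw [one_smul, sub_self, norm_zero]
    positivity
  · rw [zero_smul, sub_zero, norm_smul]
    gcongr
    exact norm_resolventSymbol_le_of_le (Nat.cast_nonneg n) (not_le.mp h4).le

theorem tendsto_norm_one_sub_cutoffOp_mul_besselOp :
    Tendsto (fun n => ‖(1 - cutoffOp n) * besselOp‖) atTop (𝓝 0) := by
  refine squeeze_zero (fun n => norm_nonneg _) norm_one_sub_cutoffOp_mul_besselOp_le ?_
  have h1 : Tendsto (fun n : ℕ => 1 + (n : ℝ) ^ 2) atTop atTop :=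
    tendsto_atTop_add_const_left _ _ ((tendsto_pow_atTop two_ne_zero).comp
      tendsto_natCast_atTop_atTop)
  have h2 := (tendsto_rpow_neg_atTop (show (0 : ℝ) < 1 / 2 by norm_num)).comp h1
  refine h2.congr fun n => ?_
  simp only [Function.comp]
  norm_num

theorem tendsto_cutoffOp (x : SpinorL2) : Tendsto (fun n => cutoffOp n x) atTop (𝓝 x) := by
  rw [Metric.tendsto_atTop]
  intro ε hε
  obtain ⟨y, hy⟩ := Metric.denseRange_iff.mp denseRange_besselOp x (ε / 3) (by positivity)
  rw [dist_eq_norm] at hy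
  have h1 : Tendsto (fun n => ‖(1 - cutoffOp n) * besselOp‖ * ‖y‖) atTop (𝓝 0) := by
    simpa using tendsto_norm_one_sub_cutoffOp_mul_besselOp.mul_const ‖y‖
  obtain ⟨N, hN⟩ := eventually_atTop.mp (h1.eventually_lt_const (show 0 < ε / 3 by positivity))
  refine ⟨N, fun n hn => ?_⟩
  have h2 := (((1 - cutoffOp n) * besselOp).le_opNorm y).trans_lt (hN n hn)
  have h3 : cutoffOp n x - x = cutoffOp n (x - besselOp y) - ((1 - cutoffOp n) * besselOp) y -
      (x - besselOp y) := by
    simp only [map_sub, mul_apply_eq_comp, sub_apply, one_apply_eq_self]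
    abel
  rw [dist_eq_norm, h3]
  refine (norm_sub_le _ _).trans_lt ?_
  refine (add_le_add (norm_sub_le _ _) le_rfl).trans_lt ?_
  linarith [norm_cutoffOp_le n (x - besselOp y)]

/-- The Galerkin scheme of the Dirac operator with a potential of relative bound zero. -/
theorem galerkinScheme_freeDiracBessel_sub {ε : ℝ} (hε : 0 < ε) {W : ℝ → SpinorL2 →L[ℂ] SpinorL2}
    (hW : ContDiff ℝ 1 W)
    (hsymm : ∀ t x y, inner ℂ (besselOp x) (W t y) = inner ℂ (W t x) (besselOp y))
    (hbound : ∀ T δ, 0 < δ → ∃ C, 0 ≤ C ∧ ∀ t, |t| ≤ T → ∀ x,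
      ‖W t x‖ ≤ δ * ‖x‖ + C * ‖besselOp x‖) :
    GalerkinScheme besselOp cutoffOp cutoffInvOp fun t => freeDiracBessel ε - W t where
  denseRange := denseRange_besselOp
  symm_P := inner_cutoffOp_left
  P_P h := cutoffOp_cutoffOp h
  R_K := besselOp_cutoffInvOp
  K_R := cutoffInvOp_besselOp
  P_K := cutoffOp_cutoffInvOp
  tendsto_P := tendsto_cutoffOp
  tendsto_P_R := tendsto_norm_one_sub_cutoffOp_mul_besselOp
  contDiff_G := contDiff_const.sub hW
  symm_G t x y := by
    rw [sub_apply, sub_apply, inner_sub_left, inner_sub_right, hsymm, inner_freeDiracBessel_left,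
      inner_besselOp_left]
    simp only [besselOp, freeDiracBessel_fourierMul]
  coercive T := by
    have hc := freeDiracConst_pos hε
    obtain ⟨C, hC0, hC⟩ := hbound T (freeDiracConst ε / 2) (by positivity)
    refine ⟨2 / freeDiracConst ε * (1 + C), by positivity, fun t ht n x hx => ?_⟩
    have h1 := norm_le_norm_freeDiracBessel hε x
    have h2 : freeDiracBessel ε x = cutoffOp n ((freeDiracBessel ε - W t) x) + cutoffOp n (W t x) := by
      rw [← map_add, sub_apply, sub_add_cancel, cutoffOp, ← freeDiracBessel_fourierMul]
      exact congrArg _ hx.symm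
    have h3 : ‖freeDiracBessel ε x‖ ≤ ‖cutoffOp n ((freeDiracBessel ε - W t) x)‖ + ‖W t x‖ := by
      rw [h2]
      exact (norm_add_le _ _).trans (add_le_add le_rfl (norm_cutoffOp_le _ _))
    have h4 := hC t ht x
    set a := ‖cutoffOp n ((freeDiracBessel ε - W t) x)‖
    set b := ‖besselOp x‖
    have ha : 0 ≤ a := norm_nonneg _
    have hb : 0 ≤ b := norm_nonneg _
    have h5 : freeDiracConst ε / 2 * ‖x‖ ≤ a + C * b := by linarith
    have h6 : a + C * b ≤ (1 + C) * (a + b) := by nlinarith [mul_nonneg hC0 ha]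
    calc ‖x‖ = 2 / freeDiracConst ε * (freeDiracConst ε / 2 * ‖x‖) := by field_simp
      _ ≤ 2 / freeDiracConst ε * ((1 + C) * (a + b)) :=
          mul_le_mul_of_nonneg_left (h5.trans h6) (by positivity)
      _ = _ := by ring

/-- A symmetric operator is self-adjoint if `T + iλ` and `T - iλ` are surjective. -/
theorem isSelfAdjoint_of_surjective {H : Type*} [NormedAddCommGroup H] [InnerProductSpace ℂ H]
    [CompleteSpace H] {T : H →ₗ.[ℂ] H} (hd : Dense (T.domain : Set H))
    (hT : ∀ x y : T.domain, inner ℂ (T x) (y : H) = inner ℂ (x : H) (T y)) (l : ℝ)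
    (h₁ : ∀ z, ∃ x : T.domain, T x + (Complex.I * l) • (x : H) = z)
    (h₂ : ∀ z, ∃ x : T.domain, T x - (Complex.I * l) • (x : H) = z) : IsSelfAdjoint T := by
  rw [LinearPMap.isSelfAdjoint_def]
  have hle : T ≤ T.adjoint := LinearPMap.IsFormalAdjoint.le_adjoint hd hT
  refine (LinearPMap.eq_of_le_of_domain_eq hle (le_antisymm hle.1 fun y hy => ?_)).symm
  have hadj : ∀ v : T.domain, inner ℂ (T.adjoint ⟨y, hy⟩) (v : H) = inner ℂ y (T v) := fun v =>
    LinearPMap.adjoint_isFormalAdjoint hd ⟨y, hy⟩ v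
  obtain ⟨x, hx⟩ := h₁ (T.adjoint ⟨y, hy⟩ + (Complex.I * l) • y)
  obtain ⟨v, hv⟩ := h₂ (y - x)
  have key : inner ℂ (y - x) (y - (x : H)) = 0 := by
    have h3 : inner ℂ (T.adjoint ⟨y, hy⟩ + (Complex.I * l) • y -
        (T x + (Complex.I * l) • (x : H))) (v : H) = 0 := by
      rw [hx, sub_self, inner_zero_left]
    nth_rewrite 2 [← hv]
    rw [inner_sub_left, inner_add_left, inner_add_left, hadj, hT, inner_smul_left,
      inner_smul_left] at h3
    simp only [map_mul, Complex.conj_I, Complex.conj_ofReal] at h3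
    rw [inner_sub_left, inner_sub_right, inner_sub_right, inner_smul_right, inner_smul_right]
    linear_combination h3
  rw [inner_self_eq_zero, sub_eq_zero] at key
  rw [key]
  exact x.2

/-- A small perturbation of an invertible operator is surjective. -/
theorem surjective_sub_of_norm_le {E : Type*} [NormedAddCommGroup E] [NormedSpace ℂ E]
    [CompleteSpace E] {A W : E →L[ℂ] E} (hA : Function.Bijective A) {q : ℝ} (hq0 : 0 ≤ q)
    (hq : q < 1) (hW : ∀ x, ‖W x‖ ≤ q * ‖A x‖) : Function.Surjective (A - W) := by
  let e := ContinuousLinearEquiv.ofBijective A (LinearMap.ker_eq_bot.mpr hA.1)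
    (LinearMap.range_eq_top.mpr hA.2)
  set B : E →L[ℂ] E := W ∘L e.symm.toContinuousLinearMap with hB
  have hAe : ∀ z, A (e.symm z) = z := fun z => e.apply_symm_apply z
  have hBn : ‖B‖ < 1 := by
    refine lt_of_le_of_lt (ContinuousLinearMap.opNorm_le_bound _ hq0 fun z => ?_) hq
    have := hW (e.symm z)
    rwa [hAe] at this
  have hu := isUnit_one_sub_of_norm_lt_one hBn
  intro z
  obtain ⟨y, hy⟩ := (ContinuousLinearMap.isUnit_iff_bijective.mp hu).2 z
  refine ⟨e.symm y, ?_⟩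
  rw [sub_apply, hAe]
  exact hy

theorem norm_sq_freeDiracBessel_add (ε l : ℝ) (x : SpinorL2) :
    ‖(freeDiracBessel ε + (Complex.I * l) • besselOp) x‖ ^ 2 =
      ‖freeDiracBessel ε x‖ ^ 2 + l ^ 2 * ‖besselOp x‖ ^ 2 := by
  have him : (inner ℂ (freeDiracBessel ε x) (besselOp x)).im = 0 := by
    have h : inner ℂ (freeDiracBessel ε x) (besselOp x) =
        inner ℂ (besselOp x) (freeDiracBessel ε x) := by
      rw [inner_freeDiracBessel_left, inner_besselOp_left]
      simp only [besselOp, freeDiracBessel_fourierMul]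
    rw [← inner_conj_symm (besselOp x)] at h
    exact Complex.conj_eq_iff_im.mp h.symm
  rw [add_apply, smul_apply, @norm_add_sq ℂ, inner_smul_right, norm_smul]
  simp [him, mul_pow]

theorem bijective_freeDiracBessel_add {ε : ℝ} (hε : 0 < ε) (l : ℝ) :
    Function.Bijective (freeDiracBessel ε + (Complex.I * l) • besselOp) := by
  have hc := freeDiracConst_pos hε
  have hbelow : ∀ (l : ℝ) x, freeDiracConst ε * ‖x‖ ≤
      ‖(freeDiracBessel ε + (Complex.I * l) • besselOp) x‖ := by
    intro l x
    refine (norm_le_norm_freeDiracBessel hε x).trans (le_of_sq_le_sq ?_ (norm_nonneg _))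
    rw [norm_sq_freeDiracBessel_add]
    nlinarith [sq_nonneg (l * ‖besselOp x‖)]
  rw [ContinuousLinearMap.bijective_iff_dense_range_and_antilipschitz]
  constructor
  · rw [Submodule.topologicalClosure_eq_top_iff, Submodule.eq_bot_iff]
    intro y hy
    have h1 : ∀ x, inner ℂ x ((freeDiracBessel ε + (Complex.I * ((-l : ℝ) : ℂ)) • besselOp) y) =
        0 := by
      intro x
      have h2 := (Submodule.mem_orthogonal _ _).mp hy
        ((freeDiracBessel ε + (Complex.I * l) • besselOp) x) ⟨x, rfl⟩
      rw [add_apply, smul_apply, inner_add_left, inner_smul_left, inner_freeDiracBessel_left,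
        inner_besselOp_left] at h2
      rw [add_apply, smul_apply, inner_add_right, inner_smul_right]
      simp only [map_mul, Complex.conj_I, Complex.conj_ofReal] at h2
      push_cast
      linear_combination h2
    have h3 := inner_self_eq_zero.mp (h1 _)
    have h4 := hbelow (-l) y
    rw [h3, norm_zero] at h4
    have h5 : ‖y‖ ≤ 0 := by
      by_contra hn
      nlinarith [mul_pos hc (not_le.mp hn)]
    exact norm_le_zero_iff.mp h5
  · refine ⟨(freeDiracConst ε)⁻¹.toNNReal, ContinuousLinearMap.antilipschitz_of_bound _ fun x => ?_⟩
    rw [Real.coe_toNNReal _ (by positivity), ← div_eq_inv_mul, le_div_iff₀ hc, mul_comm]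
    exact hbelow l x

theorem surjective_freeDiracBessel_sub_add {ε : ℝ} (hε : 0 < ε) {W : SpinorL2 →L[ℂ] SpinorL2}
    {C : ℝ}
    (hW : ∀ x, ‖W x‖ ≤ freeDiracConst ε / 4 * ‖x‖ + C * ‖besselOp x‖) {l : ℝ}
    (hl : 4 * C + 1 ≤ |l|) :
    Function.Surjective (freeDiracBessel ε + (Complex.I * l) • besselOp - W) := by
  have hc := freeDiracConst_pos hε
  refine surjective_sub_of_norm_le (bijective_freeDiracBessel_add hε l) (q := 1 / 2) (by norm_num)
    (by norm_num) fun x => ?_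
  set a := ‖(freeDiracBessel ε + (Complex.I * l) • besselOp) x‖ with ha
  have ha2 := norm_sq_freeDiracBessel_add ε l x
  rw [← ha] at ha2
  have h1 : freeDiracConst ε * ‖x‖ ≤ a := by
    refine (norm_le_norm_freeDiracBessel hε x).trans (le_of_sq_le_sq ?_ (norm_nonneg _))
    rw [ha2]
    nlinarith [sq_nonneg (l * ‖besselOp x‖)]
  have h2 : |l| * ‖besselOp x‖ ≤ a := by
    refine le_of_sq_le_sq ?_ (norm_nonneg _)
    rw [ha2, mul_pow, sq_abs]
    nlinarith [sq_nonneg ‖freeDiracBessel ε x‖]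
  have h3 : (4 * C + 1) * ‖besselOp x‖ ≤ a := le_trans (by gcongr) h2
  nlinarith [hW x, norm_nonneg (besselOp x)]

theorem eLpNorm_le_of_tendsto_of_le {α E : Type*} [MeasurableSpace α] {μ : Measure α}
    [NormedAddCommGroup E] {p : ℝ≥0∞} {f : ℕ → α → E} {g : α → E} {b : ℕ → ℝ≥0∞} {B : ℝ≥0∞}
    (hf : ∀ n, AEStronglyMeasurable (f n) μ)
    (hlim : ∀ᵐ x ∂μ, Tendsto (fun n => f n x) atTop (𝓝 (g x)))
    (hb : ∀ n, eLpNorm (f n) p μ ≤ b n) (hB : Tendsto b atTop (𝓝 B)) : eLpNorm g p μ ≤ B :=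
  calc eLpNorm g p μ ≤ liminf (fun n => eLpNorm (f n) p μ) atTop :=
        Lp.eLpNorm_lim_le_liminf_eLpNorm hf g hlim
    _ ≤ liminf b atTop := liminf_le_liminf (.of_forall hb)
    _ = B := hB.liminf_eq

/-- The Gagliardo–Nirenberg–Sobolev inequality for Schwartz functions on `ℝ³`. -/
theorem exists_eLpNorm_schwartz_le : ∃ C : ℝ≥0, ∀ u : 𝓢(Space, Spinor),
    eLpNorm u 6 volume ≤ C * eLpNorm (fderiv ℝ u) 2 volume := by
  refine ⟨SNormLESNormFDerivOfEqConst Spinor (volume : Measure Space) (2 : ℝ≥0), fun u => ?_⟩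
  set C := SNormLESNormFDerivOfEqConst Spinor (volume : Measure Space) (2 : ℝ≥0)
  let χ : ContDiffBump (0 : Space) := ⟨1, 2, one_pos, one_lt_two⟩
  obtain ⟨B, hB⟩ := (χ.hasCompactSupport.fderiv ℝ).exists_bound_of_continuous
    ((χ.contDiff (n := 1)).continuous_fderiv one_ne_zero)
  have hB0 : 0 ≤ B := (norm_nonneg _).trans (hB 0)
  set c : ℕ → ℝ := fun n => ((n : ℝ) + 1)⁻¹ with hc
  have hcpos : ∀ n, 0 < c n := fun n => by simp only [hc]; positivity
  set g : ℕ → Space → Spinor := fun n x => χ (c n • x) • u x with hg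
  have hχd : ∀ n, ContDiff ℝ 1 fun x => χ (c n • x) := fun n =>
    (χ.contDiff (n := 1)).comp (contDiff_const_smul (c n))
  have hud : ContDiff ℝ 1 u := u.smooth 1
  have hgd : ∀ n, ContDiff ℝ 1 (g n) := fun n => (hχd n).smul hud
  have hgs : ∀ n, HasCompactSupport (g n) := fun n =>
    (χ.hasCompactSupport.comp_smul (hcpos n).ne').smul_right
  have hfd : ∀ n x, ‖fderiv ℝ (g n) x‖ ≤ ‖fderiv ℝ u x‖ + c n * B * ‖u x‖ := by
    intro n x
    have h1 : fderiv ℝ (g n) x = χ (c n • x) • fderiv ℝ u x +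
        (fderiv ℝ (fun x => χ (c n • x)) x).smulRight (u x) :=
      fderiv_fun_smul ((hχd n).differentiable one_ne_zero x) (hud.differentiable one_ne_zero x)
    rw [h1]
    refine (norm_add_le _ _).trans (add_le_add ?_ ?_)
    · rw [norm_smul, Real.norm_of_nonneg χ.nonneg]
      exact mul_le_of_le_one_left (norm_nonneg _) χ.le_one
    · rw [ContinuousLinearMap.norm_smulRight_apply]
      gcongr
      rw [fderiv_comp_smul, norm_smul, Real.norm_of_nonneg (hcpos n).le]
      gcongr
      exact hB _
  have hbound : ∀ n, eLpNorm (g n) 6 volume ≤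
      C * (eLpNorm (fderiv ℝ u) 2 volume + ENNReal.ofReal (c n * B) * eLpNorm u 2 volume) := by
    intro n
    have h1 : eLpNorm (g n) ((6 : ℝ≥0) : ℝ≥0∞) volume ≤
        C * eLpNorm (fderiv ℝ (g n)) ((2 : ℝ≥0) : ℝ≥0∞) volume :=
      eLpNorm_le_eLpNorm_fderiv_of_eq volume (hgd n) (hgs n) one_le_two (by simp)
        (by simp; norm_num)
    refine h1.trans ?_
    gcongr
    calc eLpNorm (fderiv ℝ (g n)) 2 volume
        ≤ eLpNorm (fun x => ‖fderiv ℝ u x‖ + (c n * B) * ‖u x‖) 2 volume :=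
          eLpNorm_mono_real (hfd n)
      _ ≤ eLpNorm (fun x => ‖fderiv ℝ u x‖) 2 volume +
          eLpNorm (fun x => (c n * B) * ‖u x‖) 2 volume :=
          eLpNorm_add_le (hud.continuous_fderiv one_ne_zero).norm.aestronglyMeasurable
            (continuous_const.mul u.continuous.norm).aestronglyMeasurable one_le_two
      _ = _ := by
          rw [eLpNorm_norm]
          congr 1
          have h2 := eLpNorm_const_smul (c n * B) (fun x => ‖u x‖) 2 (volume : Measure Space)
          rw [eLpNorm_norm] at h2
          rw [← Real.enorm_eq_ofReal (mul_nonneg (hcpos n).le hB0), ← h2]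
          rfl
  refine eLpNorm_le_of_tendsto_of_le (fun n => (hgd n).continuous.aestronglyMeasurable)
    (.of_forall fun x => ?_) hbound ?_
  · have hc0 : Tendsto c atTop (𝓝 0) := by
      have := tendsto_one_div_add_atTop_nhds_zero_nat (𝕜 := ℝ)
      simpa [hc, one_div] using this
    have h1 : Tendsto (fun n => χ (c n • x)) atTop (𝓝 (χ ((0 : ℝ) • x))) :=
      (χ.continuous.tendsto _).comp (hc0.smul_const x)
    have h2 : χ ((0 : ℝ) • x) = 1 := by
      rw [zero_smul]
      exact χ.one_of_mem_closedBall (Metric.mem_closedBall_self zero_le_one)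
    rw [h2] at h1
    simpa using h1.smul_const (u x)
  · have hc0 : Tendsto (fun n => ENNReal.ofReal (c n * B)) atTop (𝓝 0) := by
      have h1 := (tendsto_one_div_add_atTop_nhds_zero_nat (𝕜 := ℝ)).mul_const B
      have h2 := ENNReal.tendsto_ofReal h1
      simpa [hc, one_div] using h2
    have hu2 : eLpNorm u 2 volume ≠ ∞ := (u.memLp 2 volume).2.ne
    have h3 := ENNReal.Tendsto.mul_const hc0 (Or.inr hu2)
    rw [zero_mul] at h3
    have h4 := ENNReal.Tendsto.const_mul (a := (C : ℝ≥0∞))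
      (tendsto_const_nhds (x := eLpNorm (fderiv ℝ u) 2 volume) |>.add h3)
      (Or.inr ENNReal.coe_ne_top)
    simpa using h4

theorem norm_clm_le_sum {F : Type*} [NormedAddCommGroup F] [NormedSpace ℝ F] (L : Space →L[ℝ] F) :
    ‖L‖ ≤ ∑ k, ‖L (EuclideanSpace.single k (1 : ℝ))‖ := by
  refine L.opNorm_le_bound (Finset.sum_nonneg fun _ _ => norm_nonneg _) fun v => ?_
  have h : v = ∑ k, v k • (EuclideanSpace.single k (1 : ℝ) : Space) := by
    ext i
    simp [Fin.sum_univ_three]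
    fin_cases i <;> simp
  conv_lhs => rw [h, map_sum]
  rw [Finset.sum_mul]
  refine (norm_sum_le _ _).trans (Finset.sum_le_sum fun k _ => ?_)
  rw [map_smul, norm_smul, mul_comm]
  gcongr
  exact PiLp.norm_apply_le v k

theorem besselOp_toLp (g : 𝓢(Space, Spinor)) :
    besselOp (g.toLp 2) = (SchwartzMap.fourierMultiplierCLM Spinor resolventSymbol g).toLp 2 := by
  apply toTemperedDistribution_injective
  rw [besselOp, toTemperedDistribution_fourierMul hasTemperateGrowth_resolventSymbol,
    Lp.toTemperedDistribution_toLp_eq, Lp.toTemperedDistribution_toLp_eq,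
    TemperedDistribution.fourierMultiplierCLM_toTemperedDistributionCLM_eq
      hasTemperateGrowth_resolventSymbol]

theorem derivBesselOp_toLp (k : Fin 3) (g : 𝓢(Space, Spinor)) :
    derivBesselOp k (g.toLp 2) = (∂_{(EuclideanSpace.single k (1 : ℝ) : Space)}
      (SchwartzMap.fourierMultiplierCLM Spinor resolventSymbol g)).toLp 2 := by
  apply toTemperedDistribution_injective
  rw [toTemperedDistribution_derivBesselOp, besselOp_toLp, Lp.toTemperedDistribution_toLp_eq,
    Lp.toTemperedDistribution_toLp_eq,
    TemperedDistribution.lineDerivOp_toTemperedDistributionCLM_eq]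

theorem eLpNorm_fderiv_schwartz_le (u : 𝓢(Space, Spinor)) :
    eLpNorm (fderiv ℝ u) 2 volume ≤
      ∑ k, eLpNorm (∂_{(EuclideanSpace.single k (1 : ℝ) : Space)} u : 𝓢(Space, Spinor)) 2 volume := by
  have h1 : ∀ k, eLpNorm (∂_{(EuclideanSpace.single k (1 : ℝ) : Space)} u : 𝓢(Space, Spinor)) 2 volume =
      eLpNorm (fun x => ‖fderiv ℝ u x (EuclideanSpace.single k (1 : ℝ))‖) 2 volume := by
    intro k
    rw [eLpNorm_norm]
    congr 1
  have hcont : ∀ k : Fin 3, Continuous fun x => fderiv ℝ u x (EuclideanSpace.single k (1 : ℝ)) :=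
    fun k => ((u.smooth 1).continuous_fderiv one_ne_zero).clm_apply continuous_const
  simp only [h1]
  refine le_trans (eLpNorm_mono_real fun x => ?_)
    (eLpNorm_sum_le (fun k _ => (hcont k).norm.aestronglyMeasurable) one_le_two)
  rw [Finset.sum_apply]
  exact norm_clm_le_sum (fderiv ℝ u x)

theorem exists_eLpNorm_besselOp_toLp_le : ∃ C : ℝ≥0, ∀ g : 𝓢(Space, Spinor),
    eLpNorm (besselOp (g.toLp 2)) 6 volume ≤ C * ‖(g.toLp 2 : SpinorL2)‖ₑ := by
  obtain ⟨C, hC⟩ := exists_eLpNorm_schwartz_le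
  refine ⟨C * (3 * (2 * Real.pi).toNNReal), fun g => ?_⟩
  have h1 := hC (SchwartzMap.fourierMultiplierCLM Spinor resolventSymbol g)
  have h2 : ∀ k, eLpNorm (∂_{(EuclideanSpace.single k (1 : ℝ) : Space)}
      (SchwartzMap.fourierMultiplierCLM Spinor resolventSymbol g) : 𝓢(Space, Spinor)) 2 volume ≤
        ((2 * Real.pi).toNNReal : ℝ≥0∞) * ‖(g.toLp 2 : SpinorL2)‖ₑ := by
    intro k
    rw [← eLpNorm_congr_ae (SchwartzMap.coeFn_toLp _ 2 volume), ← derivBesselOp_toLp,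
      ← Lp.enorm_def]
    have h3 : ‖derivBesselOp k (g.toLp 2)‖ ≤ 2 * Real.pi * ‖(g.toLp 2 : SpinorL2)‖ :=
      norm_fourierMul_le (norm_derivSymbol_le k) _
    rw [← ofReal_norm, ← ofReal_norm]
    refine (ENNReal.ofReal_le_ofReal h3).trans ?_
    rw [ENNReal.ofReal_mul (by positivity)]
    rfl
  rw [besselOp_toLp, eLpNorm_congr_ae (SchwartzMap.coeFn_toLp _ 2 volume)]
  refine h1.trans ?_
  have h4 := (eLpNorm_fderiv_schwartz_le
    (SchwartzMap.fourierMultiplierCLM Spinor resolventSymbol g)).trans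
      (Finset.sum_le_sum fun k _ => h2 k)
  rw [Finset.sum_const, Finset.card_univ, Fintype.card_fin, nsmul_eq_mul] at h4
  refine (mul_le_mul_right h4 _).trans (le_of_eq ?_)
  push_cast
  ring

/-- The Sobolev embedding `H¹(ℝ³) ⊆ L⁶(ℝ³)`. -/
theorem exists_eLpNorm_besselOp_le : ∃ C : ℝ≥0, ∀ x : SpinorL2,
    eLpNorm (besselOp x) 6 volume ≤ C * ‖x‖ₑ := by
  obtain ⟨C, hC⟩ := exists_eLpNorm_besselOp_toLp_le
  refine ⟨C, fun x => ?_⟩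
  have hx : x ∈ closure (Set.range (SchwartzMap.toLpCLM ℝ Spinor 2 (volume : Measure Space))) :=
    SchwartzMap.denseRange_toLpCLM ENNReal.ofNat_ne_top x
  obtain ⟨y, hy, hlim⟩ := mem_closure_iff_seq_limit.mp hx
  have h1 : ∀ n, eLpNorm (besselOp (y n)) 6 volume ≤ C * ‖y n‖ₑ := by
    intro n
    obtain ⟨g, hg⟩ := hy n
    rw [← hg]
    exact hC g
  obtain ⟨ns, hns, hae⟩ := (tendstoInMeasure_of_tendsto_Lp
    ((besselOp.continuous.tendsto x).comp hlim)).exists_seq_tendsto_ae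
  refine eLpNorm_le_of_tendsto_of_le (fun n => Lp.aestronglyMeasurable _) hae
    (fun n => h1 (ns n)) ?_
  exact ENNReal.Tendsto.const_mul ((hlim.comp hns.tendsto_atTop).enorm)
    (Or.inr ENNReal.coe_ne_top)

theorem le_add_rpow_mul_rpow {a b s : ℝ} (ha : 0 ≤ a) (hb : 0 < b) (hs : 1 ≤ s) :
    a ≤ b + b ^ (1 - s) * a ^ s := by
  rcases le_or_gt a b with h | h
  · have : 0 ≤ b ^ (1 - s) * a ^ s := by positivity
    linarith
  · have ha' : 0 < a := hb.trans h
    have h1 : a ^ (1 - s) ≤ b ^ (1 - s) :=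
      Real.rpow_le_rpow_of_nonpos hb h.le (by linarith)
    calc a = a ^ (1 - s) * a ^ s := by rw [← Real.rpow_add ha', sub_add_cancel, Real.rpow_one]
      _ ≤ b ^ (1 - s) * a ^ s := by gcongr
      _ ≤ _ := by linarith

theorem eLpNorm_ofReal_mul {α : Type*} [MeasurableSpace α] {μ : Measure α} {c : ℝ} (hc : 0 ≤ c)
    (f : α → ℝ) (p : ℝ≥0∞) :
    eLpNorm (fun x => c * f x) p μ = ENNReal.ofReal c * eLpNorm f p μ := by
  rw [← Real.enorm_eq_ofReal hc, ← eLpNorm_const_smul]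
  rfl

/-- Multiplication by a function in `Lʳ`, `3 < r < ∞`, is bounded relative to `L²` and `L⁶`. -/
theorem eLpNorm_smul_le_of_lt_top {r : ℝ≥0∞} [Fact (1 ≤ r)] (hr : 3 < r) (hr' : r ≠ ∞)
    (f : Lp ℝ r (volume : Measure Space)) {M : ℝ} (hM : 0 < M) {ψ : Space → Spinor}
    (hψ : AEStronglyMeasurable ψ volume) :
    eLpNorm (fun y => ((f y : ℝ) : ℂ) • ψ y) 2 volume ≤
      ENNReal.ofReal (M * ‖f‖) * eLpNorm ψ 2 volume +
        ENNReal.ofReal (M ^ (1 - r.toReal / 3) * ‖f‖) * eLpNorm ψ 6 volume := by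
  set ρ := r.toReal with hρ
  have hρ3 : 3 < ρ := by
    have := (ENNReal.toReal_lt_toReal ENNReal.ofNat_ne_top hr').mpr hr
    simpa using this
  rcases (norm_nonneg f).eq_or_lt with h0 | h0
  · have hf : f = 0 := norm_eq_zero.mp h0.symm
    have h1 : (fun y => ((f y : ℝ) : ℂ) • ψ y) =ᵐ[volume] 0 := by
      rw [hf]
      filter_upwards [Lp.coeFn_zero ℝ r (volume : Measure Space)] with y hy
      rw [hy]
      simp
    rw [eLpNorm_congr_ae h1, eLpNorm_zero]
    exact zero_le
  have hMN : 0 < M * ‖f‖ := by positivity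
  have hfm : AEStronglyMeasurable (fun y => ‖f y‖ ^ (ρ / 3)) (volume : Measure Space) :=
    ((Lp.aestronglyMeasurable f).norm.aemeasurable.pow_const _).aestronglyMeasurable
  have hhold : eLpNorm (fun y => ‖f y‖ ^ (ρ / 3) * ‖ψ y‖) 2 volume ≤
      ENNReal.ofReal (‖f‖ ^ (ρ / 3)) * eLpNorm ψ 6 volume := by
    have : ENNReal.HolderTriple 3 6 2 := ⟨by
      have h3 : (3 : ℝ≥0∞)⁻¹ = 2 * 6⁻¹ := by
        rw [show (6 : ℝ≥0∞) = 2 * 3 by norm_num, ENNReal.mul_inv (by simp) (by simp), ← mul_assoc,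
          ENNReal.mul_inv_cancel (by simp) (by simp), one_mul]
      have h2 : (2 : ℝ≥0∞)⁻¹ = 3 * 6⁻¹ := by
        rw [show (6 : ℝ≥0∞) = 3 * 2 by norm_num, ENNReal.mul_inv (by simp) (by simp), ← mul_assoc,
          ENNReal.mul_inv_cancel (by simp) (by simp), one_mul]
      rw [h3, h2]
      ring⟩
    have h1 := eLpNorm_smul_le_mul_eLpNorm (p := 3) (q := 6) (r := 2) hψ.norm hfm
    rw [eLpNorm_norm, eLpNorm_norm_rpow _ (by positivity)] at h1
    have h2 : (3 : ℝ≥0∞) * ENNReal.ofReal (ρ / 3) = r := by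
      rw [← ENNReal.ofReal_ofNat 3, ← ENNReal.ofReal_mul (by norm_num), mul_div_cancel₀ _
        (by norm_num), hρ, ENNReal.ofReal_toReal hr']
    rw [h2, ← Lp.enorm_def, ← ofReal_norm, ENNReal.ofReal_rpow_of_pos h0] at h1
    exact h1
  calc eLpNorm (fun y => ((f y : ℝ) : ℂ) • ψ y) 2 volume
      ≤ eLpNorm ((fun y => (M * ‖f‖) * ‖ψ y‖) +
          fun y => (M * ‖f‖) ^ (1 - ρ / 3) * (‖f y‖ ^ (ρ / 3) * ‖ψ y‖)) 2 volume := by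
        refine eLpNorm_mono_real fun y => ?_
        rw [norm_smul, Complex.norm_real, Pi.add_apply]
        have h1 := le_add_rpow_mul_rpow (norm_nonneg (f y)) hMN (show 1 ≤ ρ / 3 by linarith)
        calc ‖f y‖ * ‖ψ y‖ ≤ (M * ‖f‖ + (M * ‖f‖) ^ (1 - ρ / 3) * ‖f y‖ ^ (ρ / 3)) * ‖ψ y‖ := by
              gcongr
          _ = _ := by ring
    _ ≤ eLpNorm (fun y => (M * ‖f‖) * ‖ψ y‖) 2 volume +
          eLpNorm (fun y => (M * ‖f‖) ^ (1 - ρ / 3) * (‖f y‖ ^ (ρ / 3) * ‖ψ y‖)) 2 volume :=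
        eLpNorm_add_le (hψ.norm.const_mul _) ((hfm.mul hψ.norm).const_mul _) one_le_two
    _ ≤ _ := by
        rw [eLpNorm_ofReal_mul hMN.le, eLpNorm_ofReal_mul (by positivity), eLpNorm_norm]
        refine add_le_add le_rfl ?_
        refine (mul_le_mul_right hhold _).trans (le_of_eq ?_)
        rw [← mul_assoc, ← ENNReal.ofReal_mul (by positivity), Real.mul_rpow hM.le h0.le, mul_assoc,
          ← Real.rpow_add h0, sub_add_cancel, Real.rpow_one]

/-- Multiplication by a function in `Lʳ`, `3 < r ≤ ∞`, has relative bound zero on `H¹`. -/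
theorem exists_eLpNorm_smul_besselOp_le {r : ℝ≥0∞} [Fact (1 ≤ r)] (hr : 3 < r) {δ : ℝ}
    (hδ : 0 < δ) : ∃ C, 0 ≤ C ∧ ∀ (f : Lp ℝ r (volume : Measure Space)) (x : SpinorL2),
      eLpNorm (fun y => ((f y : ℝ) : ℂ) • besselOp x y) 2 volume ≤
        ENNReal.ofReal (‖f‖ * (δ * ‖x‖ + C * ‖besselOp x‖)) := by
  by_cases hr' : r = ∞
  · subst hr'
    refine ⟨1, zero_le_one, fun f x => ?_⟩
    have h1 : ∀ᵐ y, ‖((f y : ℝ) : ℂ) • besselOp x y‖ ≤ ‖f‖ * ‖besselOp x y‖ := by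
      filter_upwards [ae_le_eLpNormEssSup (f := f) (μ := (volume : Measure Space))] with y hy
      rw [norm_smul, Complex.norm_real]
      gcongr
      rw [← eLpNorm_exponent_top, ← Lp.enorm_def, ← ofReal_norm, ← ofReal_norm] at hy
      exact (ENNReal.ofReal_le_ofReal_iff (norm_nonneg _)).mp hy
    refine (eLpNorm_le_mul_eLpNorm_of_ae_le_mul h1 2).trans ?_
    rw [← Lp.enorm_def, ← ofReal_norm, ← ENNReal.ofReal_mul (norm_nonneg _)]
    refine ENNReal.ofReal_le_ofReal ?_
    gcongr
    have : 0 ≤ δ * ‖x‖ := by positivity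
    linarith
  · obtain ⟨C, hC⟩ := exists_eLpNorm_besselOp_le
    have hρ3 : 3 < r.toReal := by
      have := (ENNReal.toReal_lt_toReal ENNReal.ofNat_ne_top hr').mpr hr
      simpa using this
    have hlim : Tendsto (fun M : ℝ => M ^ (1 - r.toReal / 3) * (C : ℝ)) atTop (𝓝 0) := by
      have h1 := (tendsto_rpow_neg_atTop (show 0 < r.toReal / 3 - 1 by linarith)).mul_const (C : ℝ)
      rw [zero_mul] at h1
      simpa using h1
    obtain ⟨M, hM1, hM⟩ := ((hlim.eventually_le_const hδ).and (eventually_gt_atTop 0)).exists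
    refine ⟨M, hM.le, fun f x => ?_⟩
    refine (eLpNorm_smul_le_of_lt_top hr hr' f hM (Lp.aestronglyMeasurable (besselOp x))).trans ?_
    have h2 : ENNReal.ofReal (M ^ (1 - r.toReal / 3) * ‖f‖) * eLpNorm (besselOp x) 6 volume ≤
        ENNReal.ofReal (‖f‖ * (δ * ‖x‖)) := by
      refine (mul_le_mul_right (hC x) _).trans ?_
      rw [← ofReal_norm, ← ENNReal.ofReal_coe_nnreal, ← ENNReal.ofReal_mul (by positivity),
        ← ENNReal.ofReal_mul (by positivity)]
      refine ENNReal.ofReal_le_ofReal ?_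
      calc M ^ (1 - r.toReal / 3) * ‖f‖ * (C * ‖x‖) =
            ‖f‖ * ((M ^ (1 - r.toReal / 3) * C) * ‖x‖) := by ring
        _ ≤ _ := by gcongr
    refine (add_le_add le_rfl h2).trans (le_of_eq ?_)
    rw [← Lp.enorm_def, ← ofReal_norm, ← ENNReal.ofReal_mul (by positivity),
      ← ENNReal.ofReal_add (by positivity) (by positivity)]
    congr 1
    ring

theorem memLp_smul_besselOp {r : ℝ≥0∞} [Fact (1 ≤ r)] (hr : 3 < r)
    (f : Lp ℝ r (volume : Measure Space)) (x : SpinorL2) :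
    MemLp (fun y => ((f y : ℝ) : ℂ) • besselOp x y) 2 volume := by
  obtain ⟨C, -, hC⟩ := exists_eLpNorm_smul_besselOp_le hr one_pos
  exact ⟨(Complex.continuous_ofReal.comp_aestronglyMeasurable (Lp.aestronglyMeasurable f)).smul
    (Lp.aestronglyMeasurable _), (hC f x).trans_lt ENNReal.ofReal_lt_top⟩

theorem norm_besselOp_le (x : SpinorL2) : ‖besselOp x‖ ≤ ‖x‖ := by
  have h := norm_fourierMul_le (hm := memLp_resolventSymbol) norm_resolventSymbol_le_one x
  rwa [one_mul] at h

/-- The map `f ↦ f (1 - Δ/4π²)^(-1/2)` from `Lʳ`, `3 < r ≤ ∞`, to the bounded operators. -/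
theorem exists_mulBessel {r : ℝ≥0∞} [Fact (1 ≤ r)] (hr : 3 < r) :
    ∃ Φ : Lp ℝ r (volume : Measure Space) →L[ℝ] SpinorL2 →L[ℂ] SpinorL2,
      (∀ f x, Φ f x =ᵐ[volume] fun y => ((f y : ℝ) : ℂ) • besselOp x y) ∧
      ∀ δ, 0 < δ → ∃ C, 0 ≤ C ∧ ∀ f x, ‖Φ f x‖ ≤ ‖f‖ * (δ * ‖x‖ + C * ‖besselOp x‖) := by
  set φ : Lp ℝ r (volume : Measure Space) → SpinorL2 → SpinorL2 := fun f x =>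
    (memLp_smul_besselOp hr f x).toLp _ with hφ
  have hφae : ∀ f x, φ f x =ᵐ[volume] fun y => ((f y : ℝ) : ℂ) • besselOp x y := fun f x =>
    MemLp.coeFn_toLp _
  have hbound : ∀ δ, 0 < δ → ∃ C, 0 ≤ C ∧ ∀ f x, ‖φ f x‖ ≤ ‖f‖ * (δ * ‖x‖ + C * ‖besselOp x‖) := by
    intro δ hδ
    obtain ⟨C, hC0, hC⟩ := exists_eLpNorm_smul_besselOp_le hr hδ
    refine ⟨C, hC0, fun f x => ?_⟩
    rw [hφ, Lp.norm_toLp]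
    exact ENNReal.toReal_le_of_le_ofReal (by positivity) (hC f x)
  obtain ⟨C, hC0, hC⟩ := hbound 1 one_pos
  have hC' : ∀ f x, ‖φ f x‖ ≤ (1 + C) * ‖f‖ * ‖x‖ := by
    intro f x
    refine (hC f x).trans ?_
    calc ‖f‖ * (1 * ‖x‖ + C * ‖besselOp x‖) ≤ ‖f‖ * (1 * ‖x‖ + C * ‖x‖) := by
          gcongr
          exact norm_besselOp_le x
      _ = _ := by ring
  let L : Lp ℝ r (volume : Measure Space) → SpinorL2 →L[ℂ] SpinorL2 := fun f =>
    LinearMap.mkContinuous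
      { toFun := φ f
        map_add' := fun x y => by
          apply Lp.ext
          filter_upwards [hφae f (x + y), hφae f x, hφae f y, Lp.coeFn_add (φ f x) (φ f y),
            Lp.coeFn_add (besselOp x) (besselOp y)] with z h1 h2 h3 h4 h5
          rw [h1, h4, Pi.add_apply, h2, h3, map_add, h5, Pi.add_apply, smul_add]
        map_smul' := fun c x => by
          apply Lp.ext
          filter_upwards [hφae f (c • x), hφae f x, Lp.coeFn_smul c (φ f x),
            Lp.coeFn_smul c (besselOp x)] with z h1 h2 h3 h4
          rw [h1, RingHom.id_apply, h3, Pi.smul_apply, h2, map_smul, h4, Pi.smul_apply,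
            smul_comm] } ((1 + C) * ‖f‖) (hC' f)
  have hL : ∀ f x, L f x = φ f x := fun _ _ => rfl
  refine ⟨LinearMap.mkContinuous
    { toFun := L
      map_add' := fun f g => by
        ext1 x
        rw [add_apply, hL, hL, hL]
        apply Lp.ext
        filter_upwards [hφae (f + g) x, hφae f x, hφae g x, Lp.coeFn_add (φ f x) (φ g x),
          Lp.coeFn_add f g] with z h1 h2 h3 h4 h5
        rw [h1, h4, Pi.add_apply, h2, h3, h5, Pi.add_apply, Complex.ofReal_add, add_smul]
      map_smul' := fun c f => by
        ext1 x
        have hc : (c • φ f x : SpinorL2) = (c : ℂ) • φ f x := (Complex.coe_smul c (φ f x)).symm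
        rw [RingHom.id_apply, smul_apply, hL, hL, hc]
        apply Lp.ext
        filter_upwards [hφae (c • f) x, hφae f x, Lp.coeFn_smul (c : ℂ) (φ f x),
          Lp.coeFn_smul c f] with z h1 h2 h3 h4
        rw [h1, h3, Pi.smul_apply, h2, h4, Pi.smul_apply, smul_eq_mul, Complex.ofReal_mul,
          mul_smul] } (1 + C)
    fun f => ContinuousLinearMap.opNorm_le_bound _ (by positivity) (hC' f), hφae, hbound⟩

/-- Smallness relative to the inverse of `besselOp`, locally uniformly in time. -/
def IsRelativelySmall (W : ℝ → SpinorL2 →L[ℂ] SpinorL2) : Prop :=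
  ∀ T δ, 0 < δ → ∃ C, 0 ≤ C ∧ ∀ t, |t| ≤ T → ∀ x, ‖W t x‖ ≤ δ * ‖x‖ + C * ‖besselOp x‖

theorem IsRelativelySmall.add {W₁ W₂ : ℝ → SpinorL2 →L[ℂ] SpinorL2} (h₁ : IsRelativelySmall W₁)
    (h₂ : IsRelativelySmall W₂) : IsRelativelySmall fun t => W₁ t + W₂ t := by
  intro T δ hδ
  obtain ⟨C₁, hC₁, h₁⟩ := h₁ T (δ / 2) (half_pos hδ)
  obtain ⟨C₂, hC₂, h₂⟩ := h₂ T (δ / 2) (half_pos hδ)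
  refine ⟨C₁ + C₂, add_nonneg hC₁ hC₂, fun t ht x => (norm_add_le (W₁ t x) (W₂ t x)).trans ?_⟩
  linarith [h₁ t ht x, h₂ t ht x]

theorem IsRelativelySmall.sum {ι : Type*} {s : Finset ι} {W : ι → ℝ → SpinorL2 →L[ℂ] SpinorL2}
    (h : ∀ i ∈ s, IsRelativelySmall (W i)) : IsRelativelySmall fun t => ∑ i ∈ s, W i t := by
  classical
  induction s using Finset.induction_on with
  | empty =>
    intro T δ hδ
    refine ⟨0, le_rfl, fun t _ x => ?_⟩
    simp only [Finset.sum_empty, zero_apply, norm_zero]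
    positivity
  | insert i s hi ih =>
    simp only [Finset.sum_insert hi]
    exact (h i (Finset.mem_insert_self i s)).add (ih fun j hj => h j (Finset.mem_insert_of_mem hj))

theorem IsRelativelySmall.const_mul {W : ℝ → SpinorL2 →L[ℂ] SpinorL2} (h : IsRelativelySmall W)
    (A : SpinorL2 →L[ℂ] SpinorL2) : IsRelativelySmall fun t => A * W t := by
  intro T δ hδ
  have hA : 0 < ‖A‖ + 1 := by positivity
  obtain ⟨C, hC, h⟩ := h T (δ / (‖A‖ + 1)) (by positivity)
  refine ⟨(‖A‖ + 1) * C, by positivity, fun t ht x => ?_⟩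
  calc ‖(A * W t) x‖ ≤ ‖A‖ * ‖W t x‖ := A.le_opNorm _
    _ ≤ (‖A‖ + 1) * (δ / (‖A‖ + 1) * ‖x‖ + C * ‖besselOp x‖) := by
        gcongr
        · linarith
        · exact h t ht x
    _ = _ := by field_simp

theorem isRelativelySmall_of_continuous {E : Type*} [NormedAddCommGroup E] [NormedSpace ℝ E]
    {Φ : E →L[ℝ] SpinorL2 →L[ℂ] SpinorL2}
    (hΦ : ∀ δ, 0 < δ → ∃ C, 0 ≤ C ∧ ∀ f x, ‖Φ f x‖ ≤ ‖f‖ * (δ * ‖x‖ + C * ‖besselOp x‖))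
    {B : ℝ → E} (hB : Continuous B) : IsRelativelySmall fun t => Φ (B t) := by
  intro T δ hδ
  obtain ⟨b, hb0, hb⟩ := GalerkinScheme.exists_norm_le hB 0 T
  have hb1 : 0 < b + 1 := by positivity
  obtain ⟨C, hC, h⟩ := hΦ (δ / (b + 1)) (by positivity)
  refine ⟨(b + 1) * C, by positivity, fun t ht x => ?_⟩
  calc ‖Φ (B t) x‖ ≤ ‖B t‖ * (δ / (b + 1) * ‖x‖ + C * ‖besselOp x‖) := h _ _
    _ ≤ (b + 1) * (δ / (b + 1) * ‖x‖ + C * ‖besselOp x‖) := by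
        gcongr
        linarith [hb t (by simpa using ht)]
    _ = _ := by field_simp

theorem potentialMatrix_conjTranspose (a : Fin 4 → ℝ) :
    (potentialMatrix a).conjTranspose = potentialMatrix a := by
  simp [potentialMatrix, Matrix.conjTranspose_sum, diracAlpha_conjTranspose]

/-- A time-dependent potential composed with `besselOp`, as a family of bounded operators. -/
theorem exists_potentialBessel {r : ℝ≥0∞} [Fact (1 ≤ r)] (hr : 3 < r)
    {A : Fin 4 → ℝ → Space → ℝ} {B : Fin 4 → ℝ → Lp ℝ r (volume : Measure Space)}
    {B' : Fin 4 → ℝ → Lp ℝ ∞ (volume : Measure Space)}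
    (hB : ∀ μ, ContDiff ℝ 1 (B μ)) (hB' : ∀ μ, ContDiff ℝ 1 (B' μ))
    (hA : ∀ μ t, A μ t =ᵐ[volume] fun x => B μ t x + B' μ t x) :
    ∃ W : ℝ → SpinorL2 →L[ℂ] SpinorL2, ContDiff ℝ 1 W ∧ IsRelativelySmall W ∧
      ∀ t x, W t x =ᵐ[volume] potentialMul (fun μ => A μ t) (besselOp x) := by
  obtain ⟨Φ, hΦ, hΦb⟩ := exists_mulBessel hr
  obtain ⟨Φ', hΦ', hΦb'⟩ := exists_mulBessel (r := ∞) (by simp)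
  set V : Fin 4 → ℝ → SpinorL2 →L[ℂ] SpinorL2 := fun μ t => Φ (B μ t) + Φ' (B' μ t) with hV
  have hVd : ∀ μ, ContDiff ℝ 1 (V μ) := fun μ =>
    (Φ.contDiff.comp (hB μ)).add (Φ'.contDiff.comp (hB' μ))
  have hVs : ∀ μ, IsRelativelySmall (V μ) := fun μ =>
    (isRelativelySmall_of_continuous hΦb (hB μ).continuous).add
      (isRelativelySmall_of_continuous hΦb' (hB' μ).continuous)
  have hVae : ∀ μ t x, V μ t x =ᵐ[volume] fun y => ((A μ t y : ℝ) : ℂ) • besselOp x y := by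
    intro μ t x
    filter_upwards [hΦ (B μ t) x, hΦ' (B' μ t) x, hA μ t,
      Lp.coeFn_add (Φ (B μ t) x) (Φ' (B' μ t) x)] with y h1 h2 h3 h4
    rw [hV, add_apply, h4, Pi.add_apply, h1, h2, h3, Complex.ofReal_add, add_smul]
  refine ⟨fun t => (∑ k : Fin 3, matrixAct (diracAlpha k) * V k.succ t) + V 0 t, ?_, ?_, ?_⟩
  · exact (ContDiff.sum fun k _ => contDiff_const.mul (hVd _)).add (hVd 0)
  · exact (IsRelativelySmall.sum fun k _ => (hVs _).const_mul _).add (hVs 0)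
  · intro t x
    beta_reduce
    rw [Fin.sum_univ_three]
    have hα := fun k : Fin 3 => coeFn_matrixAct (diracAlpha k) (V k.succ t x)
    have hv := fun μ => hVae μ t x
    filter_upwards [hα 0, hα 1, hα 2, hv 0, hv (Fin.succ 0), hv (Fin.succ 1), hv (Fin.succ 2),
      Lp.coeFn_add (matrixAct (diracAlpha 0) (V (Fin.succ 0) t x) +
        matrixAct (diracAlpha 1) (V (Fin.succ 1) t x) +
        matrixAct (diracAlpha 2) (V (Fin.succ 2) t x)) (V 0 t x),
      Lp.coeFn_add (matrixAct (diracAlpha 0) (V (Fin.succ 0) t x) +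
        matrixAct (diracAlpha 1) (V (Fin.succ 1) t x))
        (matrixAct (diracAlpha 2) (V (Fin.succ 2) t x)),
      Lp.coeFn_add (matrixAct (diracAlpha 0) (V (Fin.succ 0) t x))
        (matrixAct (diracAlpha 1) (V (Fin.succ 1) t x))]
      with y a0 a1 a2 v0 v1 v2 v3 s1 s2 s3
    simp only [add_apply, mul_apply_eq_comp]
    rw [s1, Pi.add_apply, s2, Pi.add_apply, s3, Pi.add_apply, a0, a1, a2, v0, v1, v2, v3]
    simp only [potentialMul, potentialMatrix, Fin.sum_univ_three, map_add, map_smul, map_one,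
      add_apply, smul_apply, one_apply_eq_self]

section Potential

variable {A : Fin 4 → Space → ℝ} {W : SpinorL2 →L[ℂ] SpinorL2}

theorem inner_besselOp_potentialBessel
    (hW : ∀ x, W x =ᵐ[volume] potentialMul A (besselOp x)) (x y : SpinorL2) :
    inner ℂ (besselOp x) (W y) = inner ℂ (W x) (besselOp y) := by
  rw [L2.inner_def, L2.inner_def]
  apply integral_congr_ae
  filter_upwards [hW x, hW y] with z h1 h2
  have h3 : ContinuousLinearMap.adjoint
      (Matrix.toEuclideanCLM (n := Fin 4) (𝕜 := ℂ) (potentialMatrix fun μ => A μ z)) =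
      Matrix.toEuclideanCLM (n := Fin 4) (𝕜 := ℂ) (potentialMatrix fun μ => A μ z) := by
    rw [← ContinuousLinearMap.star_eq_adjoint, ← map_star, Matrix.star_eq_conjTranspose,
      potentialMatrix_conjTranspose]
  rw [h1, h2]
  simp only [potentialMul]
  rw [← ContinuousLinearMap.adjoint_inner_left, h3]

theorem diracDomain_eq (hW : ∀ x, W x =ᵐ[volume] potentialMul A (besselOp x)) :
    diracDomain A = sobolevH1 := by
  refine le_antisymm (diracDomain_le A) fun ψ hψ => ⟨hψ, ?_⟩
  obtain ⟨x, rfl⟩ := (mem_sobolevH1_iff ψ).mp hψ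
  exact (memLp_congr_ae (hW x)).mp (Lp.memLp (W x))

theorem diracHamiltonian_apply (hW : ∀ x, W x =ᵐ[volume] potentialMul A (besselOp x)) (ε : ℝ)
    {ψ : SpinorL2} (hψ : ψ ∈ (diracHamiltonian ε A).domain) {x : SpinorL2} (hx : ψ = besselOp x) :
    diracHamiltonian ε A ⟨ψ, hψ⟩ = (freeDiracBessel ε - W) x := by
  subst hx
  have h1 : potentialOp A ⟨besselOp x, hψ⟩ = W x := by
    apply Lp.ext
    exact (MemLp.coeFn_toLp (show besselOp x ∈ diracDomain A from hψ).2).trans (hW x).symm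
  rw [sub_apply, ← h1, ← freeDirac_besselOp]
  rfl

theorem isSelfAdjoint_diracHamiltonian (hW : ∀ x, W x =ᵐ[volume] potentialMul A (besselOp x))
    {ε : ℝ} (hε : 0 < ε) {C : ℝ}
    (hb : ∀ x, ‖W x‖ ≤ freeDiracConst ε / 4 * ‖x‖ + C * ‖besselOp x‖) :
    IsSelfAdjoint (diracHamiltonian ε A) := by
  have hdom : (diracHamiltonian ε A).domain = sobolevH1 := diracDomain_eq hW
  have hmem : ∀ x, besselOp x ∈ (diracHamiltonian ε A).domain := fun x => by
    rw [hdom]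
    exact besselOp_mem_sobolevH1 x
  have hex : ∀ ψ : (diracHamiltonian ε A).domain, ∃ x, (ψ : SpinorL2) = besselOp x := fun ψ => by
    obtain ⟨x, hx⟩ := (mem_sobolevH1_iff _).mp (hdom.le ψ.2)
    exact ⟨x, hx.symm⟩
  refine isSelfAdjoint_of_surjective ?_ ?_ (4 * C + 1) ?_ ?_
  · refine Dense.mono ?_ denseRange_besselOp
    rintro _ ⟨x, rfl⟩
    exact hmem x
  · rintro ⟨ψ, hψ⟩ ⟨φ, hφ⟩
    obtain ⟨x, hx⟩ := hex ⟨ψ, hψ⟩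
    obtain ⟨y, hy⟩ := hex ⟨φ, hφ⟩
    simp only at hx hy
    rw [diracHamiltonian_apply hW ε hψ hx, diracHamiltonian_apply hW ε hφ hy]
    simp only
    rw [hx, hy, sub_apply, sub_apply, inner_sub_left, inner_sub_right,
      inner_besselOp_potentialBessel hW, inner_freeDiracBessel_left, inner_besselOp_left]
    simp only [besselOp, freeDiracBessel_fourierMul]
  · intro z
    obtain ⟨x, hx⟩ := surjective_freeDiracBessel_sub_add hε hb (l := 4 * C + 1) (le_abs_self _) z
    refine ⟨⟨besselOp x, hmem x⟩, ?_⟩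
    rw [diracHamiltonian_apply hW ε (hmem x) rfl, ← hx]
    simp only [add_apply, sub_apply, smul_apply]
    abel
  · intro z
    obtain ⟨x, hx⟩ := surjective_freeDiracBessel_sub_add hε hb (l := -(4 * C + 1))
      (by rw [abs_neg]; exact le_abs_self _) z
    refine ⟨⟨besselOp x, hmem x⟩, ?_⟩
    rw [diracHamiltonian_apply hW ε (hmem x) rfl, ← hx]
    simp only [add_apply, sub_apply, smul_apply]
    rw [Complex.ofReal_neg, mul_neg, neg_smul]
    abel

end Potential

end DiracEvolution

end

open DiracEvolution in
theorem mainTheorem4 (ε : ℝ) (hε : 0 < ε) (r : ℝ≥0∞) [Fact (1 ≤ r)] (hr : 3 < r)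
    (A : Fin 4 → ℝ → Space → ℝ)
    (B : Fin 4 → ℝ → Lp ℝ r (volume : Measure Space))
    (B' : Fin 4 → ℝ → Lp ℝ ∞ (volume : Measure Space))
    (hB : ∀ μ, ContDiff ℝ 1 (B μ)) (hB' : ∀ μ, ContDiff ℝ 1 (B' μ))
    (hA : ∀ μ t, A μ t =ᵐ[volume] fun x => B μ t x + B' μ t x) :
    (∀ t : ℝ, (diracHamiltonian ε fun μ => A μ t).domain = sobolevH1 ∧
      IsSelfAdjoint (diracHamiltonian ε fun μ => A μ t)) ∧
    ∃ U : ℝ → ℝ → SpinorL2 ≃ₗᵢ[ℂ] SpinorL2, IsUnitaryPropagator U ∧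
      ∀ ψ ∈ sobolevH1, ∀ s t : ℝ,
        ∃ h : U t s ψ ∈ (diracHamiltonian ε fun μ => A μ t).domain,
          DifferentiableAt ℝ (fun τ : ℝ => U τ s ψ) t ∧
          Complex.I • deriv (fun τ : ℝ => U τ s ψ) t =
            diracHamiltonian ε (fun μ => A μ t) ⟨U t s ψ, h⟩ := by
  obtain ⟨W, hWd, hWs, hW⟩ := exists_potentialBessel hr hB hB' hA
  have hdom : ∀ t, (diracHamiltonian ε fun μ => A μ t).domain = sobolevH1 := fun t =>
    diracDomain_eq (hW t)
  refine ⟨fun t => ⟨hdom t, ?_⟩, ?_⟩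
  · obtain ⟨C, -, hb⟩ := hWs |t| (freeDiracConst ε / 4)
      (div_pos (freeDiracConst_pos hε) (by norm_num))
    exact isSelfAdjoint_diracHamiltonian (hW t) hε (hb t le_rfl)
  · obtain ⟨U, hU0, hUc, hUcont, hU⟩ := (galerkinScheme_freeDiracBessel_sub hε hWd
      (fun t => inner_besselOp_potentialBessel (hW t)) hWs).exists_propagator
    refine ⟨U, ⟨hU0, hUc, hUcont⟩, fun ψ hψ s t => ?_⟩
    obtain ⟨x, rfl⟩ := (mem_sobolevH1_iff ψ).mp hψ
    obtain ⟨y, hy, hd⟩ := hU x s t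
    have hmem : U t s (besselOp x) ∈ (diracHamiltonian ε fun μ => A μ t).domain := by
      rw [hdom, hy]
      exact besselOp_mem_sobolevH1 y
    refine ⟨hmem, hd.differentiableAt, ?_⟩
    rw [hd.deriv, diracHamiltonian_apply (hW t) ε hmem hy, smul_neg, smul_smul, Complex.I_mul_I,
      neg_smul, one_smul, neg_neg]
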